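/- Theorem 4.3. For a permutation $\sigma$ of $[n]=\{1,\dots,n\}$, the point $(i,\sigma(i))$ is a record if it is a left-to-right maximum ($\sigma(j)<\sigma(i)$ for all $j<i$), a left-to-right minimum ($\sigma(j)>\sigma(i)$ for all $j<i$), a right-to-left maximum ($\sigma(j)<\sigma(i)$ for all $j>i$) or a right-to-left minimum ($\sigma(j)>\sigma(i)$ for all $j>i$). Let $Sq(n)$ be the set of square permutations of size $n$, that is, the permutations of $[n]$ all of whose points are records. A permuton is a Borel probability measure $\mu$ on $[0,1]^2$ such that $\mu([a,b]\times[0,1])=\mu([0,1]\times[a,b])=b-a$ for all $0\le a\le b\le 1$; the set $\mathcal M$ of permutons carries the topology of weak convergence of measures and its Borel $\sigma$-algebra. For a permutation $\sigma$ of size $n\ge 1$, let $\mu_\sigma$ be the permuton $$\mu_\sigma(A)=n\sum_{i=1}^n \mathrm{Leb}\Big(A\cap\big[\tfrac{i-1}{n},\tfrac{i}{n}\big]\times\big[\tfrac{\sigma(i)-1}{n},\tfrac{\sigma(i)}{n}\big]\Big).$$ For $z\in[0,1]$, let $L_1,L_2,L_3,L_4$ be the segments joining $(0,z)$ to $(z,0)$,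 $(0,z)$ to $(1-z,1)$, $(z,0)$ to $(1,1-z)$, and $(1-z,1)$ to $(1,1-z)$, respectively, which form the boundary of a rectangle with sides of slope $\pm1$ and bottom corner $(z,0)$. Let $\mu^z$ be the permuton $$\mu^z(S)=\tfrac12\sum_{i=1}^4\nu\big(\pi_x(S\cap L_i)\big),$$ where $\nu$ is the Lebesgue measure on $[0,1]$ and $\pi_x$ is the projection to the first coordinate. For every $n\ge1$ let $\boldsymbol\sigma_n$ be a uniform random element of $Sq(n)$, and let $\boldsymbol z$ be uniform on $(0,1)$. Then, as $n\to\infty$, the random permuton $\mu_{\boldsymbol\sigma_n}$ converges in distribution, as a random element of $\mathcal M$, to the random permuton $\mu^{\boldsymbol z}$. -/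

import Mathlib

open MeasureTheory ProbabilityTheory Set Filter Topology
open scoped ENNReal

namespace SquarePermuton

noncomputable section

/-! ### Square permutations

A permutation of size `n` is an element of `Equiv.Perm (Fin n)`; positions and values run
through `0, …, n - 1` instead of `1, …, n`. -/

/-- `(i, σ i)` is a left-to-right maximum. -/
def IsLRMax {n : ℕ} (σ : Equiv.Perm (Fin n)) (i : Fin n) : Prop := ∀ j, j < i → σ j < σ i

/-- `(i, σ i)` is a left-to-right minimum. -/
def IsLRMin {n : ℕ} (σ : Equiv.Perm (Fin n)) (i : Fin n) : Prop := ∀ j, j < i → σ i < σ j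

/-- `(i, σ i)` is a right-to-left maximum. -/
def IsRLMax {n : ℕ} (σ : Equiv.Perm (Fin n)) (i : Fin n) : Prop := ∀ j, i < j → σ j < σ i

/-- `(i, σ i)` is a right-to-left minimum. -/
def IsRLMin {n : ℕ} (σ : Equiv.Perm (Fin n)) (i : Fin n) : Prop := ∀ j, i < j → σ i < σ j

/-- A record is a maximum or minimum, either from the left or from the right. -/
def IsRecord {n : ℕ} (σ : Equiv.Perm (Fin n)) (i : Fin n) : Prop :=
  IsLRMax σ i ∨ IsLRMin σ i ∨ IsRLMax σ i ∨ IsRLMin σ i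

/-- `Sq n`: the permutations of size `n` all of whose points are records. -/
def Sq (n : ℕ) : Type := {σ : Equiv.Perm (Fin n) // ∀ i, IsRecord σ i}

/-- The finite set `Sq n` carries the discrete σ-algebra. -/
instance (n : ℕ) : MeasurableSpace (Sq n) := ⊤

instance (n : ℕ) : DiscreteMeasurableSpace (Sq n) := ⟨fun _ => trivial⟩

instance (n : ℕ) : Finite (Sq n) := inferInstanceAs (Finite {σ : Equiv.Perm (Fin n) // ∀ i, IsRecord σ i})

instance (n : ℕ) : Nonempty (Sq n) := ⟨⟨1, fun _ => Or.inl fun _ h => h⟩⟩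

/-! ### Permutons -/

/-- A Borel measure on the unit square has uniform marginals if
`μ ([a, b] × [0, 1]) = μ ([0, 1] × [a, b]) = b - a` for all `0 ≤ a ≤ b ≤ 1`. -/
def HasUniformMarginals (μ : Measure (unitInterval × unitInterval)) : Prop :=
  ∀ a b : unitInterval, a ≤ b →
    μ (Icc a b ×ˢ univ) = ENNReal.ofReal ((b : ℝ) - a) ∧
    μ (univ ×ˢ Icc a b) = ENNReal.ofReal ((b : ℝ) - a)

/-- A permuton is a Borel probability measure on the unit square with uniform marginals. -/
def Permuton : Type :=
  {μ : ProbabilityMeasure (unitInterval × unitInterval) // HasUniformMarginals (μ : Measure (unitInterval × unitInterval))}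

/-- The topology of weak convergence on the set of permutons. -/
instance : TopologicalSpace Permuton :=
  inferInstanceAs (TopologicalSpace
    {μ : ProbabilityMeasure (unitInterval × unitInterval) // HasUniformMarginals (μ : Measure (unitInterval × unitInterval))})

/-- The Borel σ-algebra of the weak topology. -/
instance : MeasurableSpace Permuton := borel Permuton

instance : BorelSpace Permuton := ⟨rfl⟩

theorem isProbabilityMeasure_of_hasUniformMarginals {μ : Measure (unitInterval × unitInterval)}
    (h : HasUniformMarginals μ) : IsProbabilityMeasure μ := by
  refine ⟨?_⟩
  have h1 := (h 0 1 zero_le_one).1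
  have h2 : Icc (0 : unitInterval) 1 = univ := by
    ext t; simp [unitInterval.le_one']
  rw [h2, univ_prod_univ] at h1
  simpa using h1

/-- The permuton given by a measure with uniform marginals. -/
def Permuton.mk (μ : Measure (unitInterval × unitInterval)) (h : HasUniformMarginals μ) : Permuton :=
  ⟨⟨μ, isProbabilityMeasure_of_hasUniformMarginals h⟩, h⟩

theorem volume_of_mem_iff {s : Set unitInterval} {l u : ℝ} (hl : 0 ≤ l) (hu : u ≤ 1)
    (h : ∀ t : unitInterval, t ∈ s ↔ l ≤ t ∧ (t : ℝ) ≤ u) : volume s = ENNReal.ofReal (u - l) := by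
  have : (Subtype.val '' s : Set ℝ) = Icc l u := by
    ext x
    constructor
    · rintro ⟨t, ht, rfl⟩
      exact (h t).1 ht
    · intro hx
      exact ⟨⟨x, hl.trans hx.1, hx.2.trans hu⟩, (h _).2 hx, rfl⟩
  rw [unitInterval.volume_apply, this, Real.volume_Icc]

/-! ### The permuton of a permutation -/

/-- The interval `[k / n, (k + 1) / n]` of the unit interval. -/
def cell (n : ℕ) (k : Fin n) : Set unitInterval := {t | (k : ℝ) / n ≤ t ∧ (t : ℝ) ≤ ((k : ℝ) + 1) / n}

/-- `n` times the sum of the area measures on the `n` squares of side `1 / n` that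
belong to the points of `σ`. -/
def permMeasure {n : ℕ} (σ : Equiv.Perm (Fin n)) : Measure (unitInterval × unitInterval) :=
  (n : ℝ≥0∞) • ∑ i : Fin n, (volume : Measure (unitInterval × unitInterval)).restrict (cell n i ×ˢ cell n (σ i))

theorem cell_le_one {n : ℕ} (k : Fin n) : ((k : ℝ) + 1) / n ≤ 1 := by
  have h : (k : ℕ) + 1 ≤ n := k.2
  have h' : (k : ℝ) + 1 ≤ n := by exact_mod_cast h
  exact div_le_one_of_le₀ h' (Nat.cast_nonneg n)

theorem volume_cell {n : ℕ} (k : Fin n) : volume (cell n k) = (n : ℝ≥0∞)⁻¹ := by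
  have hn : 0 < n := k.pos
  rw [volume_of_mem_iff (s := cell n k) (l := (k : ℝ) / n) (u := ((k : ℝ) + 1) / n) (by positivity)
    (cell_le_one k) (fun t => Iff.rfl), ← sub_div, add_sub_cancel_left, one_div,
    ENNReal.ofReal_inv_of_pos (by exact_mod_cast hn), ENNReal.ofReal_natCast]

theorem sum_volume_inter_cell (n : ℕ) [NeZero n] {a b : unitInterval} (hab : a ≤ b) :
    ∑ i : Fin n, volume (Icc a b ∩ cell n i) = ENNReal.ofReal ((b : ℝ) - a) := by
  have hab' : (a : ℝ) ≤ b := hab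
  have hn : (n : ℝ) ≠ 0 := by exact_mod_cast NeZero.ne n
  let f : ℕ → ℝ := fun k => max a (min b ((k : ℝ) / n))
  have hstep : ∀ i : Fin n, volume (Icc a b ∩ cell n i)
      = ENNReal.ofReal (f ((i : ℕ) + 1) - f i) := by
    intro i
    have hn' : (0 : ℝ) < n := by exact_mod_cast i.pos
    have hlt : (i : ℝ) / n ≤ ((i : ℝ) + 1) / n := by gcongr; linarith
    rw [volume_of_mem_iff (l := max a ((i : ℝ) / n)) (u := min b (((i : ℝ) + 1) / n))
      (le_max_of_le_left a.2.1) (min_le_of_left_le b.2.2)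
      (fun t => by
        simp only [cell, mem_inter_iff, mem_Icc, mem_ofPred_eq, max_le_iff, le_min_iff,
          ← Subtype.coe_le_coe]
        tauto)]
    simp only [f]
    push_cast
    generalize (i : ℝ) / n = x at hlt
    generalize ((i : ℝ) + 1) / n = y at hlt
    rcases le_total y a with h1 | h1
    · rw [min_eq_right (h1.trans hab'), min_eq_right (hlt.trans (h1.trans hab')),
        max_eq_left h1, max_eq_left (hlt.trans h1), sub_self,
        ENNReal.ofReal_of_nonpos (by linarith), ENNReal.ofReal_zero]
    · rcases le_total x b with h2 | h2
      · rw [max_eq_right (le_min hab' h1), min_eq_right h2]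
      · rw [min_eq_left h2, min_eq_left (h2.trans hlt), max_eq_right hab', sub_self,
          max_eq_right (hab'.trans h2), ENNReal.ofReal_of_nonpos (by linarith),
          ENNReal.ofReal_zero]
  have hmono : ∀ k : ℕ, f k ≤ f (k + 1) := by
    intro k
    simp only [f]
    gcongr
    linarith
  rw [Finset.sum_congr rfl (fun i _ => hstep i),
    ← ENNReal.ofReal_sum_of_nonneg (f := fun i : Fin n => f ((i : ℕ) + 1) - f i)
      (fun i _ => sub_nonneg.2 (hmono (i : ℕ))),
    Fin.sum_univ_eq_sum_range (fun k => f (k + 1) - f k) n, Finset.sum_range_sub f n]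
  congr 1
  simp only [f]
  rw [div_self hn, min_eq_left b.2.2, max_eq_right hab']
  simp [a.2.1, b.2.1]

theorem hasUniformMarginals_permMeasure {n : ℕ} [NeZero n] (σ : Equiv.Perm (Fin n)) :
    HasUniformMarginals (permMeasure σ) := by
  intro a b hab
  have hn : (n : ℝ≥0∞) ≠ 0 := by exact_mod_cast NeZero.ne n
  have hn' : (n : ℝ≥0∞) ≠ ∞ := ENNReal.natCast_ne_top n
  constructor
  · rw [← sum_volume_inter_cell n hab, permMeasure, Measure.smul_apply,
      Measure.finsetSum_apply, smul_eq_mul, Finset.mul_sum]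
    refine Finset.sum_congr rfl fun i _ => ?_
    rw [Measure.restrict_apply (measurableSet_Icc.prod MeasurableSet.univ), prod_inter_prod,
      univ_inter, Measure.volume_eq_prod, Measure.prod_prod, volume_cell, mul_comm,
      mul_assoc, ENNReal.inv_mul_cancel hn hn', mul_one]
  · rw [← sum_volume_inter_cell n hab, permMeasure, Measure.smul_apply,
      Measure.finsetSum_apply, smul_eq_mul, Finset.mul_sum,
      ← Equiv.sum_comp σ (fun i => volume (Icc a b ∩ cell n i))]
    refine Finset.sum_congr rfl fun i _ => ?_
    rw [Measure.restrict_apply (MeasurableSet.univ.prod measurableSet_Icc), prod_inter_prod,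
      univ_inter, Measure.volume_eq_prod, Measure.prod_prod, volume_cell, ← mul_assoc,
      ENNReal.mul_inv_cancel hn hn', one_mul]

/-- The permuton `μ_σ` of a permutation `σ` of size `n ≥ 1`. -/
def permPermuton {n : ℕ} [NeZero n] (σ : Equiv.Perm (Fin n)) : Permuton :=
  Permuton.mk (permMeasure σ) (hasUniformMarginals_permMeasure σ)

/-! ### The rectangle permuton

The four sides of the rectangle with vertices `(0, z)`, `(z, 0)`, `(1, 1 - z)`, `(1 - z, 1)`. -/

/-- The segment from `(0, z)` to `(z, 0)`. -/
def L1 (z : unitInterval) : Set (unitInterval × unitInterval) := {p | (p.1 : ℝ) + p.2 = z}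

/-- The segment from `(0, z)` to `(1 - z, 1)`. -/
def L2 (z : unitInterval) : Set (unitInterval × unitInterval) := {p | (p.2 : ℝ) - p.1 = z}

/-- The segment from `(z, 0)` to `(1, 1 - z)`. -/
def L3 (z : unitInterval) : Set (unitInterval × unitInterval) := {p | (p.1 : ℝ) - p.2 = z}

/-- The segment from `(1 - z, 1)` to `(1, 1 - z)`. -/
def L4 (z : unitInterval) : Set (unitInterval × unitInterval) := {p | (p.1 : ℝ) + p.2 = 2 - z}

/-- The measure `S ↦ ν (π_x (S ∩ L)) / 2` on the graph `L` of a function `g` over a set `D` of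
abscissas, `ν` being the Lebesgue measure (see `sideMeasure_apply`). The values of `g` are
truncated to `[0, 1]`, which changes nothing when `g` maps `D` to `[0, 1]`. -/
def sideMeasure (D : Set unitInterval) (g : ℝ → ℝ) : Measure (unitInterval × unitInterval) :=
  (2 : ℝ≥0∞)⁻¹ •
    ((volume : Measure unitInterval).restrict D).map fun t : unitInterval => (t, projIcc 0 1 zero_le_one (g t))

/-- The rescaled Lebesgue measure on `L1 z`. -/
def side1 (z : unitInterval) : Measure (unitInterval × unitInterval) := sideMeasure {t | (t : ℝ) ≤ z} fun t => z - t

/-- The rescaled Lebesgue measure on `L2 z`. -/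
def side2 (z : unitInterval) : Measure (unitInterval × unitInterval) := sideMeasure {t | (t : ℝ) ≤ 1 - z} fun t => t + z

/-- The rescaled Lebesgue measure on `L3 z`. -/
def side3 (z : unitInterval) : Measure (unitInterval × unitInterval) := sideMeasure {t | (z : ℝ) ≤ t} fun t => t - z

/-- The rescaled Lebesgue measure on `L4 z`. -/
def side4 (z : unitInterval) : Measure (unitInterval × unitInterval) := sideMeasure {t | 1 - (z : ℝ) ≤ t} fun t => 2 - z - t

/-- The measure `μ^z` on the boundary of the rectangle. -/
def rectMeasure (z : unitInterval) : Measure (unitInterval × unitInterval) := side1 z + side2 z + side3 z + side4 z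

theorem sideMeasure_apply_preimage {D : Set unitInterval} {g : ℝ → ℝ} (hg : Continuous g)
    {S : Set (unitInterval × unitInterval)} (hS : MeasurableSet S) :
    sideMeasure D g S = (2 : ℝ≥0∞)⁻¹ *
      volume ({t : unitInterval | (t, projIcc 0 1 zero_le_one (g t)) ∈ S} ∩ D) := by
  have hf : Measurable fun t : unitInterval => (t, (projIcc 0 1 zero_le_one (g t) : unitInterval)) :=
    (continuous_id.prodMk (continuous_projIcc.comp
      (hg.comp continuous_subtype_val))).measurable
  rw [sideMeasure, Measure.smul_apply, smul_eq_mul, Measure.map_apply hf hS,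
    Measure.restrict_apply (hf hS)]
  rfl

theorem sideMeasure_apply {D : Set unitInterval} {g : ℝ → ℝ} (hg : Continuous g) {L : Set (unitInterval × unitInterval)}
    (hL : ∀ p : unitInterval × unitInterval, p ∈ L ↔ p.1 ∈ D ∧ (p.2 : ℝ) = g p.1)
    (hD : ∀ t ∈ D, g (t : ℝ) ∈ Icc (0 : ℝ) 1) {S : Set (unitInterval × unitInterval)} (hS : MeasurableSet S) :
    sideMeasure D g S = (2 : ℝ≥0∞)⁻¹ * volume (Prod.fst '' (S ∩ L)) := by
  rw [sideMeasure_apply_preimage hg hS]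
  congr 2
  ext t
  constructor
  · rintro ⟨h1, h2⟩
    refine ⟨_, ⟨h1, (hL _).2 ⟨h2, ?_⟩⟩, rfl⟩
    rw [projIcc_of_mem zero_le_one (hD t h2)]
  · rintro ⟨p, ⟨hp, hpL⟩, rfl⟩
    obtain ⟨h1, h2⟩ := (hL p).1 hpL
    refine ⟨?_, h1⟩
    have : (projIcc 0 1 zero_le_one (g p.1) : unitInterval) = p.2 := by
      rw [← h2, projIcc_val]
    rw [mem_ofPred_eq, this]
    exact hp

/-- `μ^z (S)` is the sum over the four sides `L` of `ν (π_x (S ∩ L)) / 2`. -/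
theorem rectMeasure_apply (z : unitInterval) {S : Set (unitInterval × unitInterval)} (hS : MeasurableSet S) :
    rectMeasure z S =
      (2 : ℝ≥0∞)⁻¹ * volume (Prod.fst '' (S ∩ L1 z)) +
      (2 : ℝ≥0∞)⁻¹ * volume (Prod.fst '' (S ∩ L2 z)) +
      (2 : ℝ≥0∞)⁻¹ * volume (Prod.fst '' (S ∩ L3 z)) +
      (2 : ℝ≥0∞)⁻¹ * volume (Prod.fst '' (S ∩ L4 z)) := by
  have hz0 := z.2.1
  have hz1 := z.2.2
  simp only [rectMeasure, Measure.add_apply]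
  congr 1
  · congr 1
    · congr 1
      · refine sideMeasure_apply (by fun_prop) (fun p => ?_) (fun t ht => ?_) hS
        · have := p.2.2.1
          simp only [L1, mem_ofPred_eq]
          constructor
          · intro h; constructor <;> linarith
          · rintro ⟨h, h'⟩; linarith
        · have := t.2.1
          simp only [mem_ofPred_eq] at ht
          constructor <;> linarith
      · refine sideMeasure_apply (by fun_prop) (fun p => ?_) (fun t ht => ?_) hS
        · have := p.2.2.2
          simp only [L2, mem_ofPred_eq]
          constructor
          · intro h; constructor <;> linarith
          · rintro ⟨h, h'⟩; linarith
        · have := t.2.1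
          simp only [mem_ofPred_eq] at ht
          constructor <;> linarith
    · refine sideMeasure_apply (by fun_prop) (fun p => ?_) (fun t ht => ?_) hS
      · have := p.2.2.1
        simp only [L3, mem_ofPred_eq]
        constructor
        · intro h; constructor <;> linarith
        · rintro ⟨h, h'⟩; linarith
      · have := t.2.2
        simp only [mem_ofPred_eq] at ht
        constructor <;> linarith
  · refine sideMeasure_apply (by fun_prop) (fun p => ?_) (fun t ht => ?_) hS
    · have := p.2.2.2
      simp only [L4, mem_ofPred_eq]
      constructor
      · intro h; constructor <;> linarith
      · rintro ⟨h, h'⟩; linarith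
    · have := t.2.2
      simp only [mem_ofPred_eq] at ht
      constructor <;> linarith

theorem mem_image_fst {S : Set (unitInterval × unitInterval)} {t : unitInterval} :
    t ∈ Prod.fst '' S ↔ ∃ y : unitInterval, (t, y) ∈ S := by
  simp

theorem hasUniformMarginals_rectMeasure (z : unitInterval) : HasUniformMarginals (rectMeasure z) := by
  intro a b hab
  have hab' : (a : ℝ) ≤ b := hab
  have ha0 := a.2.1
  have hb1 := b.2.2
  have hz0 := z.2.1
  have hz1 := z.2.2
  have half : ∀ x y u v : ℝ, max x 0 + max y 0 + max u 0 + max v 0 = 2 * ((b : ℝ) - a) →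
      (2 : ℝ≥0∞)⁻¹ * ENNReal.ofReal x + (2 : ℝ≥0∞)⁻¹ * ENNReal.ofReal y +
      (2 : ℝ≥0∞)⁻¹ * ENNReal.ofReal u + (2 : ℝ≥0∞)⁻¹ * ENNReal.ofReal v
      = ENNReal.ofReal ((b : ℝ) - a) := by
    intro x y u v h
    have e : ∀ w : ℝ, ENNReal.ofReal w = ENNReal.ofReal (max w 0) := fun w => by
      rcases le_total w 0 with hw | hw
      · rw [max_eq_right hw, ENNReal.ofReal_of_nonpos hw, ENNReal.ofReal_zero]
      · rw [max_eq_left hw]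
    rw [← mul_add, ← mul_add, ← mul_add, e x, e y, e u, e v,
      ← ENNReal.ofReal_add (by positivity) (by positivity),
      ← ENNReal.ofReal_add (by positivity) (by positivity),
      ← ENNReal.ofReal_add (by positivity) (by positivity), h,
      ENNReal.ofReal_mul (by norm_num), ENNReal.ofReal_ofNat, ← mul_assoc,
      ENNReal.inv_mul_cancel (by norm_num) (by norm_num), one_mul]
  have pairx : ∀ w : ℝ,
      max (min (b : ℝ) w - a) 0 + max ((b : ℝ) - max (a : ℝ) w) 0 = b - a := by
    intro w
    rcases le_total w a with h | h
    · rw [min_eq_right (h.trans hab'), max_eq_left h, max_eq_right (by linarith),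
        max_eq_left (by linarith), zero_add]
    · rcases le_total w b with h' | h'
      · rw [min_eq_right h', max_eq_right h, max_eq_left (by linarith),
          max_eq_left (by linarith)]
        ring
      · rw [min_eq_left h', max_eq_right h, max_eq_left (by linarith),
          max_eq_right (by linarith), add_zero]
  have pairl : max ((z : ℝ) - a - max 0 ((z : ℝ) - b)) 0
      + max ((b : ℝ) - z - max 0 ((a : ℝ) - z)) 0 = b - a := by
    have h := pairx z
    rw [add_comm, ← h, add_comm]
    congr 2
    · rcases le_total (z : ℝ) b with h | h
      · rw [max_eq_left (by linarith), min_eq_right h]; ring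
      · rw [max_eq_right (by linarith), min_eq_left h]; ring
    · rcases le_total (z : ℝ) a with h | h
      · rw [max_eq_right (by linarith), max_eq_left h]; ring
      · rw [max_eq_left (by linarith), max_eq_right h]; ring
  have pairr : max (min 1 ((b : ℝ) + z) - ((a : ℝ) + z)) 0
      + max (min 1 (2 - (z : ℝ) - a) - (2 - (z : ℝ) - b)) 0 = b - a := by
    have h := pairx (1 - z)
    rw [← h]
    congr 2
    · rcases le_total (b : ℝ) (1 - z) with h | h
      · rw [min_eq_right (by linarith), min_eq_left h]; ring
      · rw [min_eq_left (by linarith), min_eq_right h]; ring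
    · rcases le_total (a : ℝ) (1 - z) with h | h
      · rw [min_eq_left (by linarith), max_eq_right h]; ring
      · rw [min_eq_right (by linarith), max_eq_left h]; ring
  constructor
  · rw [rectMeasure_apply z (measurableSet_Icc.prod MeasurableSet.univ),
      volume_of_mem_iff (s := Prod.fst '' (Icc a b ×ˢ univ ∩ L1 z)) (l := a) (u := min b z)
        ha0 (min_le_of_left_le hb1) ?_,
      volume_of_mem_iff (s := Prod.fst '' (Icc a b ×ˢ univ ∩ L2 z)) (l := a)
        (u := min b (1 - z)) ha0 (min_le_of_left_le hb1) ?_,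
      volume_of_mem_iff (s := Prod.fst '' (Icc a b ×ˢ univ ∩ L3 z)) (l := max a z)
        (u := b) (le_max_of_le_left ha0) hb1 ?_,
      volume_of_mem_iff (s := Prod.fst '' (Icc a b ×ˢ univ ∩ L4 z)) (l := max a (1 - z))
        (u := b) (le_max_of_le_left ha0) hb1 ?_]
    · apply half
      have h1 := pairx z
      have h2 := pairx (1 - z)
      linarith
    · intro t
      have := t.2.1
      rw [mem_image_fst]
      constructor
      · rintro ⟨y, ⟨⟨h1, -⟩, h2⟩⟩
        have := y.2.2
        simp only [L4, mem_ofPred_eq, mem_Icc, ← Subtype.coe_le_coe] at h1 h2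
        exact ⟨max_le h1.1 (by linarith), h1.2⟩
      · rintro ⟨h1, h2⟩
        have h3 := max_le_iff.1 h1
        have := t.2.2
        exact ⟨⟨2 - z - t, by linarith, by linarith⟩, ⟨⟨h3.1, h2⟩, mem_univ _⟩,
          by simp [L4]⟩
    · intro t
      rw [mem_image_fst]
      constructor
      · rintro ⟨y, ⟨⟨h1, -⟩, h2⟩⟩
        have := y.2.1
        simp only [L3, mem_ofPred_eq, mem_Icc, ← Subtype.coe_le_coe] at h1 h2
        exact ⟨max_le h1.1 (by linarith), h1.2⟩
      · rintro ⟨h1, h2⟩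
        have h3 := max_le_iff.1 h1
        have := t.2.2
        exact ⟨⟨t - z, by linarith, by linarith⟩, ⟨⟨h3.1, h2⟩, mem_univ _⟩,
          by simp [L3]⟩
    · intro t
      rw [mem_image_fst]
      constructor
      · rintro ⟨y, ⟨⟨h1, -⟩, h2⟩⟩
        have := y.2.2
        simp only [L2, mem_ofPred_eq, mem_Icc, ← Subtype.coe_le_coe] at h1 h2
        exact ⟨h1.1, le_min h1.2 (by linarith)⟩
      · rintro ⟨h1, h2⟩
        have h3 := le_min_iff.1 h2
        have := t.2.1
        exact ⟨⟨t + z, by linarith, by linarith⟩, ⟨⟨h1, h3.1⟩, mem_univ _⟩,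
          by simp [L2]⟩
    · intro t
      rw [mem_image_fst]
      constructor
      · rintro ⟨y, ⟨⟨h1, -⟩, h2⟩⟩
        have := y.2.1
        simp only [L1, mem_ofPred_eq, mem_Icc, ← Subtype.coe_le_coe] at h1 h2
        exact ⟨h1.1, le_min h1.2 (by linarith)⟩
      · rintro ⟨h1, h2⟩
        have h3 := le_min_iff.1 h2
        have := t.2.1
        exact ⟨⟨z - t, by linarith, by linarith⟩, ⟨⟨h1, h3.1⟩, mem_univ _⟩,
          by simp [L1]⟩
  · rw [rectMeasure_apply z (MeasurableSet.univ.prod measurableSet_Icc),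
      volume_of_mem_iff (s := Prod.fst '' (univ ×ˢ Icc a b ∩ L1 z)) (l := max 0 (z - b))
        (u := z - a) (le_max_left _ _) (by linarith) ?_,
      volume_of_mem_iff (s := Prod.fst '' (univ ×ˢ Icc a b ∩ L2 z)) (l := max 0 (a - z))
        (u := b - z) (le_max_left _ _) (by linarith) ?_,
      volume_of_mem_iff (s := Prod.fst '' (univ ×ˢ Icc a b ∩ L3 z)) (l := a + z)
        (u := min 1 (b + z)) (by linarith) (min_le_left _ _) ?_,
      volume_of_mem_iff (s := Prod.fst '' (univ ×ˢ Icc a b ∩ L4 z)) (l := 2 - z - b)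
        (u := min 1 (2 - z - a)) (by linarith) (min_le_left _ _) ?_]
    · apply half
      linarith
    · intro t
      rw [mem_image_fst]
      constructor
      · rintro ⟨y, ⟨⟨-, h1⟩, h2⟩⟩
        have := t.2.2
        simp only [L4, mem_ofPred_eq, mem_Icc, ← Subtype.coe_le_coe] at h1 h2
        exact ⟨by linarith, le_min this (by linarith)⟩
      · rintro ⟨h1, h2⟩
        have h3 := le_min_iff.1 h2
        exact ⟨⟨2 - z - t, by linarith, by linarith⟩, ⟨mem_univ _,
          (by change (a : ℝ) ≤ 2 - z - t; linarith), (by change 2 - z - t ≤ (b : ℝ); linarith)⟩,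
          by simp [L4]⟩
    · intro t
      rw [mem_image_fst]
      constructor
      · rintro ⟨y, ⟨⟨-, h1⟩, h2⟩⟩
        have := t.2.2
        simp only [L3, mem_ofPred_eq, mem_Icc, ← Subtype.coe_le_coe] at h1 h2
        exact ⟨by linarith, le_min this (by linarith)⟩
      · rintro ⟨h1, h2⟩
        have h3 := le_min_iff.1 h2
        exact ⟨⟨t - z, by linarith, by linarith⟩, ⟨mem_univ _,
          (by change (a : ℝ) ≤ t - z; linarith), (by change t - z ≤ (b : ℝ); linarith)⟩,
          by simp [L3]⟩
    · intro t
      rw [mem_image_fst]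
      constructor
      · rintro ⟨y, ⟨⟨-, h1⟩, h2⟩⟩
        have := t.2.1
        simp only [L2, mem_ofPred_eq, mem_Icc, ← Subtype.coe_le_coe] at h1 h2
        exact ⟨max_le this (by linarith), by linarith⟩
      · rintro ⟨h1, h2⟩
        have h3 := max_le_iff.1 h1
        exact ⟨⟨t + z, by linarith, by linarith⟩, ⟨mem_univ _,
          (by change (a : ℝ) ≤ t + z; linarith), (by change t + z ≤ (b : ℝ); linarith)⟩,
          by simp [L2]⟩
    · intro t
      rw [mem_image_fst]
      constructor
      · rintro ⟨y, ⟨⟨-, h1⟩, h2⟩⟩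
        have := t.2.1
        simp only [L1, mem_ofPred_eq, mem_Icc, ← Subtype.coe_le_coe] at h1 h2
        exact ⟨max_le this (by linarith), by linarith⟩
      · rintro ⟨h1, h2⟩
        have h3 := max_le_iff.1 h1
        exact ⟨⟨z - t, by linarith, by linarith⟩, ⟨mem_univ _,
          (by change (a : ℝ) ≤ z - t; linarith), (by change z - t ≤ (b : ℝ); linarith)⟩,
          by simp [L1]⟩

/-- The permuton `μ^z`. -/
def rectPermuton (z : unitInterval) : Permuton :=
  Permuton.mk (rectMeasure z) (hasUniformMarginals_rectMeasure z)

end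

end SquarePermuton

/-! A square permutation is coded by the position `z` of its minimum and two binary words. The word
`X` marks the positions of the points on the two upper sides; the word `Y` marks the values of the
points on the two left sides. Along each side the points are monotone, so they are matched by rank,
and the permutation can be read off from `X`, `Y` and `z` (`isDecoding_of_isRecord`,
`IsDecoding.unique`). For an inner `z` three letters of `X` and two letters of `Y` are forced, hence
at most `numAdmissible n` square permutations have their minimum at `z`.

Conversely, if every prefix of both words has about as many letters of either kind, up to `δ`, and
`z` is at distance more than about `6δ` from both ends, the matching always produces a square
permutation with exactly these labels (`numAdmissible_le_card_sqFiber`). A fourth moment estimate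
shows that unbalanced words are a vanishing proportion for `δ` of order `n ^ (7/8)`. So almost all
`z` carry almost the same number of square permutations: the minimum is asymptotically uniform, and
the labels are typically balanced.

Balance also gives the geometry. In the rank equations each count may be replaced by half the length
of the prefix, with total error `3δ`, and they become the equations of the four sides of the
rectangle with parameter `z / n`. Summation by parts against the word `X` shows that the upper and
the lower boundary each receive half of the mass uniformly. Hence integrals of Lipschitz functions
against the two permutons differ by a multiple of `(δ + 1) / n` (`abs_integral_permMeasure_sub_le`).
Compactness of the parameter interval extends this to every continuous function of the permuton
(`exists_err_bound`), and the average over square permutations becomes a Riemann sum for the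
integral over `z` (`tendsto_sum_div`). -/

namespace SquarePermuton

/-! ### Counting labels in prefixes of a word -/

/-- The number of letters `b` among the first `k` letters of the word `X`. -/
def cnt {n : ℕ} (X : Fin n → Bool) (b : Bool) (k : ℕ) : ℕ :=
  (Finset.univ.filter fun i : Fin n => (i : ℕ) < k ∧ X i = b).card

section Count

variable {n : ℕ} (X : Fin n → Bool) (b : Bool)

theorem cnt_zero : cnt X b 0 = 0 := by simp [cnt]

theorem cnt_succ (i : Fin n) : cnt X b ((i : ℕ) + 1) = cnt X b i + if X i = b then 1 else 0 := by
  unfold cnt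
  split_ifs with h
  · rw [← Finset.card_insert_of_notMem (a := i) (by simp)]
    congr 1
    ext j
    simp only [Finset.mem_filter, Finset.mem_univ, true_and, Finset.mem_insert]
    constructor
    · rintro ⟨h1, h2⟩
      rcases Nat.lt_succ_iff_lt_or_eq.1 h1 with h3 | h3
      · exact Or.inr ⟨h3, h2⟩
      · exact Or.inl (Fin.ext h3)
    · rintro (rfl | ⟨h1, h2⟩)
      · exact ⟨Nat.lt_succ_self _, h⟩
      · exact ⟨by omega, h2⟩
  · rw [add_zero]
    congr 1
    ext j
    simp only [Finset.mem_filter, Finset.mem_univ, true_and]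
    constructor
    · rintro ⟨h1, h2⟩
      rcases Nat.lt_succ_iff_lt_or_eq.1 h1 with h3 | h3
      · exact ⟨h3, h2⟩
      · exact absurd (Fin.ext h3 ▸ h2) h
    · rintro ⟨h1, h2⟩
      exact ⟨by omega, h2⟩

theorem cnt_succ_of_eq {i : Fin n} (h : X i = b) : cnt X b ((i : ℕ) + 1) = cnt X b i + 1 := by
  rw [cnt_succ, if_pos h]

theorem cnt_mono : Monotone (cnt X b) := fun k l h =>
  Finset.card_le_card fun i hi => by
    simp only [Finset.mem_filter] at hi ⊢
    exact ⟨hi.1, hi.2.1.trans_le h, hi.2.2⟩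

theorem cnt_lt_cnt {i : Fin n} (h : X i = b) {k : ℕ} (hk : (i : ℕ) < k) :
    cnt X b i < cnt X b k := by
  have h1 := cnt_mono X b (Nat.succ_le_of_lt hk)
  rw [Nat.succ_eq_add_one, cnt_succ_of_eq X b h] at h1
  omega

theorem lt_of_cnt_lt_cnt {k l : ℕ} (h : cnt X b k < cnt X b l) : k < l := by
  by_contra h'
  exact absurd (cnt_mono X b (not_lt.1 h')) (by omega)

theorem eq_of_cnt_eq {i j : Fin n} (hi : X i = b) (hj : X j = b) (h : cnt X b i = cnt X b j) :
    i = j := by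
  rcases lt_trichotomy i j with h1 | h1 | h1
  · exact absurd h (cnt_lt_cnt X b hi (Fin.lt_def.1 h1)).ne
  · exact h1
  · exact absurd h (cnt_lt_cnt X b hj (Fin.lt_def.1 h1)).ne'

theorem cnt_add_cnt {k : ℕ} (hk : k ≤ n) : cnt X true k + cnt X false k = k := by
  induction k with
  | zero => simp [cnt_zero]
  | succ k ih =>
    have h1 := cnt_succ X true ⟨k, hk⟩
    have h2 := cnt_succ X false ⟨k, hk⟩
    have h3 := ih (by omega)
    simp only at h1 h2
    rw [h1, h2]
    cases X ⟨k, hk⟩ <;> simp <;> omega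

/-- A discrete intermediate value argument: prefix counts start at `0` and grow by at most one per
letter. Together with `eq_of_cnt_eq` it lets the letters `b` be enumerated by rank. -/
theorem exists_cnt_eq {m k : ℕ} (hk : k ≤ n) (h : m < cnt X b k) :
    ∃ i : Fin n, X i = b ∧ cnt X b i = m := by
  induction k with
  | zero => simp [cnt_zero] at h
  | succ k ih =>
    by_cases h1 : m < cnt X b k
    · exact ih (by omega) h1
    · have h2 := cnt_succ X b ⟨k, hk⟩
      simp only at h2
      rw [h2] at h
      by_cases h3 : X ⟨k, hk⟩ = b
      · refine ⟨⟨k, hk⟩, h3, ?_⟩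
        rw [if_pos h3] at h
        simp only
        omega
      · rw [if_neg h3] at h
        omega

/-- The letters of `Y` before `v` are counted by the positions of the smaller values of `σ`. -/
theorem cnt_apply_perm (Y : Fin n → Bool) (σ : Equiv.Perm (Fin n)) (v : ℕ) :
    cnt Y b v = (Finset.univ.filter fun k : Fin n => (σ k : ℕ) < v ∧ Y (σ k) = b).card := by
  unfold cnt
  refine (Finset.card_equiv σ fun k => ?_).symm
  simp

theorem card_filter_Ioo_eq {p q : ℕ} (hpq : p ≤ q) :
    (Finset.univ.filter fun k : Fin n => (p ≤ (k : ℕ) ∧ (k : ℕ) < q) ∧ X k = b).card + cnt X b p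
      = cnt X b q := by
  unfold cnt
  rw [← Finset.card_union_of_disjoint]
  · congr 1
    ext k
    simp only [Finset.mem_union, Finset.mem_filter, Finset.mem_univ, true_and, ← or_and_right]
    refine and_congr_left fun _ => ?_
    omega
  · rw [Finset.disjoint_left]
    intro k hk
    simp only [Finset.mem_filter, Finset.mem_univ, true_and, not_and] at hk ⊢
    omega

end Count

/-! ### The labels of a permutation -/

section Labels

variable {n : ℕ}

open Classical in
/-- The label of a position: `true` for the left-to-right and right-to-left maxima. -/
noncomputable def posLabel (σ : Equiv.Perm (Fin n)) (i : Fin n) : Bool :=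
  decide (IsLRMax σ i ∨ IsRLMax σ i)

open Classical in
/-- The label of a value: `true` for the values of the left-to-right records that are not
right-to-left maxima. -/
noncomputable def valLabel (σ : Equiv.Perm (Fin n)) (j : Fin n) : Bool :=
  decide (¬ IsRLMax σ (σ.symm j) ∧ (IsLRMax σ (σ.symm j) ∨ IsLRMin σ (σ.symm j)))

theorem posLabel_eq_true {σ : Equiv.Perm (Fin n)} {i : Fin n} :
    posLabel σ i = true ↔ IsLRMax σ i ∨ IsRLMax σ i := by
  simp [posLabel]

theorem posLabel_eq_false {σ : Equiv.Perm (Fin n)} {i : Fin n} :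
    posLabel σ i = false ↔ ¬ IsLRMax σ i ∧ ¬ IsRLMax σ i := by
  simp [posLabel]

theorem valLabel_eq_true {σ : Equiv.Perm (Fin n)} {i : Fin n} :
    valLabel σ (σ i) = true ↔ ¬ IsRLMax σ i ∧ (IsLRMax σ i ∨ IsLRMin σ i) := by
  simp [valLabel]

theorem valLabel_eq_false {σ : Equiv.Perm (Fin n)} {i : Fin n} :
    valLabel σ (σ i) = false ↔ IsRLMax σ i ∨ (¬ IsLRMax σ i ∧ ¬ IsLRMin σ i) := by
  rw [← Bool.not_eq_true, valLabel_eq_true]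
  tauto

/-- The values of `σ` are given by the labels `X` of the positions, the labels `Y` of the values
and the position `z` of the minimum: the points are matched in order along each of the four
sides. -/
structure IsDecoding (X Y : Fin n → Bool) (z : Fin n) (σ : Equiv.Perm (Fin n)) : Prop where
  lowLeft : ∀ i, X i = false → i ≤ z → Y (σ i) = true ∧
    cnt Y true (σ i) + cnt X false ((i : ℕ) + 1) = cnt X false ((z : ℕ) + 1)
  lowRight : ∀ i, X i = false → z < i → Y (σ i) = false ∧
    cnt Y false (σ i) + cnt X false ((z : ℕ) + 1) = cnt X false i
  upLeft : ∀ i, X i = true → cnt X true i + cnt X false ((z : ℕ) + 1) < cnt Y true n →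
    Y (σ i) = true ∧ cnt Y true (σ i) = cnt X true i + cnt X false ((z : ℕ) + 1)
  upRight : ∀ i, X i = true → cnt Y true n ≤ cnt X true i + cnt X false ((z : ℕ) + 1) →
    Y (σ i) = false ∧ cnt Y false (σ i) + cnt X true i + cnt X false ((z : ℕ) + 1) + 1 = n

/-- On each side the equations fix both the letter and the rank of the value, and these two
determine the value. -/
theorem IsDecoding.unique {X Y : Fin n → Bool} {z : Fin n} {σ τ : Equiv.Perm (Fin n)}
    (hσ : IsDecoding X Y z σ) (hτ : IsDecoding X Y z τ) : σ = τ := by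
  ext1 i
  rcases hX : X i with _ | _
  · rcases le_or_gt i z with h | h
    · have h1 := hσ.lowLeft i hX h
      have h2 := hτ.lowLeft i hX h
      exact eq_of_cnt_eq Y true h1.1 h2.1 (by omega)
    · have h1 := hσ.lowRight i hX h
      have h2 := hτ.lowRight i hX h
      exact eq_of_cnt_eq Y false h1.1 h2.1 (by omega)
  · rcases lt_or_ge (cnt X true i + cnt X false ((z : ℕ) + 1)) (cnt Y true n) with h | h
    · have h1 := hσ.upLeft i hX h
      have h2 := hτ.upLeft i hX h
      exact eq_of_cnt_eq Y true h1.1 h2.1 (by omega)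
    · have h1 := hσ.upRight i hX h
      have h2 := hτ.upRight i hX h
      exact eq_of_cnt_eq Y false h1.1 h2.1 (by omega)

/-- A square permutation is given by its labels and the position of its minimum. -/
theorem isDecoding_of_isRecord {σ : Equiv.Perm (Fin n)} (hσ : ∀ i, IsRecord σ i) {z : Fin n}
    (hz : (σ z : ℕ) = 0) : IsDecoding (posLabel σ) (valLabel σ) z σ := by
  have hmin : ∀ j, j ≠ z → σ z < σ j := fun j hj => by
    rw [Fin.lt_def, hz]
    refine Nat.pos_of_ne_zero fun h => hj (σ.injective (Fin.ext (h.trans hz.symm)))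
  have lowL : ∀ i, posLabel σ i = false → i ≤ z → IsLRMin σ i := fun i hi hiz => by
    rw [posLabel_eq_false] at hi
    rcases hσ i with h | h | h | h
    · exact absurd h hi.1
    · exact h
    · exact absurd h hi.2
    -- A right-to-left minimum to the left of `z` would lie below the minimum, so only `i = z`
    -- remains.
    · rcases hiz.lt_or_eq with h1 | rfl
      · exact absurd (h z h1) (hmin i h1.ne).not_gt
      · exact fun j hj => hmin j hj.ne
  have lowL' : ∀ i, posLabel σ i = false → i ≤ z → valLabel σ (σ i) = true := fun i hi hiz => by
    rw [valLabel_eq_true]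
    exact ⟨(posLabel_eq_false.1 hi).2, Or.inr (lowL i hi hiz)⟩
  have nLRMin : ∀ i, z < i → ¬ IsLRMin σ i := fun i hi h => (h z hi).not_gt (hmin i hi.ne')
  have lowR : ∀ i, posLabel σ i = false → z < i → IsRLMin σ i := fun i hi hiz => by
    rw [posLabel_eq_false] at hi
    rcases hσ i with h | h | h | h
    · exact absurd h hi.1
    · exact absurd h (nLRMin i hiz)
    · exact absurd h hi.2
    · exact h
  have lowR' : ∀ i, posLabel σ i = false → z < i → valLabel σ (σ i) = false := fun i hi hiz => by
    rw [valLabel_eq_false]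
    exact Or.inr ⟨(posLabel_eq_false.1 hi).1, nLRMin i hiz⟩
  have upL : ∀ i, posLabel σ i = true → valLabel σ (σ i) = true → IsLRMax σ i := fun i h1 h2 => by
    rw [posLabel_eq_true] at h1
    rw [valLabel_eq_true] at h2
    tauto
  have upR : ∀ i, posLabel σ i = true → valLabel σ (σ i) = false → IsRLMax σ i :=
      fun i h1 h2 => by
    rw [posLabel_eq_true] at h1
    rw [valLabel_eq_false] at h2
    tauto
  have hX : ∀ i, posLabel σ i = true ∨ posLabel σ i = false := fun i => by
    cases posLabel σ i <;> simp
  have hY : ∀ i, valLabel σ i = true ∨ valLabel σ i = false := fun i => by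
    cases valLabel σ i <;> simp
  have ne_of : ∀ i k, posLabel σ i = true → posLabel σ k = false → i ≠ k := by
    rintro i k h1 h2 rfl
    simp [h1] at h2
  -- order relations between the points of different sides
  have sepL : ∀ i k, posLabel σ i = false → i ≤ z → posLabel σ k = true →
      valLabel σ (σ k) = true → σ i < σ k := fun i k h1 h2 h3 h4 => by
    rcases lt_trichotomy i k with h | h | h
    · exact upL k h3 h4 i h
    · exact absurd h.symm (ne_of k i h3 h1)
    · exact lowL i h1 h2 k h
  have sepR : ∀ i k, posLabel σ i = false → z < i → posLabel σ k = true →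
      valLabel σ (σ k) = false → σ i < σ k := fun i k h1 h2 h3 h4 => by
    rcases lt_trichotomy i k with h | h | h
    · exact lowR i h1 h2 k h
    · exact absurd h.symm (ne_of k i h3 h1)
    · exact upR k h3 h4 i h
  have sepU : ∀ i k, posLabel σ i = true → valLabel σ (σ i) = true → posLabel σ k = true →
      valLabel σ (σ k) = false → i < k := fun i k h1 h2 h3 h4 => by
    rcases lt_trichotomy i k with h | h | h
    · exact h
    · subst h; simp [h2] at h4
    · exact absurd (upL i h1 h2 k h) (upR k h3 h4 i h).not_gt
  have monL : ∀ i k, posLabel σ i = false → i ≤ z → posLabel σ k = false → k ≤ z →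
      (σ k < σ i ↔ i < k) := fun i k h1 h2 h3 h4 => by
    constructor
    · intro h
      by_contra h'
      rcases (not_lt.1 h').lt_or_eq with h5 | rfl
      · exact (lowL i h1 h2 k h5).not_gt h
      · exact lt_irrefl _ h
    · exact lowL k h3 h4 i
  have monR : ∀ i k, posLabel σ i = false → z < i → posLabel σ k = false → z < k →
      (σ k < σ i ↔ k < i) := fun i k h1 h2 h3 h4 => by
    constructor
    · intro h
      by_contra h'
      rcases (not_lt.1 h').lt_or_eq with h5 | rfl
      · exact (lowR i h1 h2 k h5).not_gt h
      · exact lt_irrefl _ h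
    · exact lowR k h3 h4 i
  have monUL : ∀ i k, posLabel σ i = true → valLabel σ (σ i) = true → posLabel σ k = true →
      valLabel σ (σ k) = true → (σ k < σ i ↔ k < i) := fun i k h1 h2 h3 h4 => by
    constructor
    · intro h
      by_contra h'
      rcases (not_lt.1 h').lt_or_eq with h5 | rfl
      · exact (upL k h3 h4 i h5).not_gt h
      · exact lt_irrefl _ h
    · exact upL i h1 h2 k
  have monUR : ∀ i k, posLabel σ i = true → valLabel σ (σ i) = false → posLabel σ k = true →
      valLabel σ (σ k) = false → (σ k < σ i ↔ i < k) := fun i k h1 h2 h3 h4 => by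
    constructor
    · intro h
      by_contra h'
      rcases (not_lt.1 h').lt_or_eq with h5 | rfl
      · exact (upR k h3 h4 i h5).not_gt h
      · exact lt_irrefl _ h
    · exact upR i h1 h2 k
  -- Among the values on the left sides, those below an upper left point come from the upper left
  -- points before it and from all lower left points.
  have cntL : ∀ i, posLabel σ i = true → valLabel σ (σ i) = true →
      cnt (valLabel σ) true (σ i) = cnt (posLabel σ) true i + cnt (posLabel σ) false (z + 1) := by
    intro i h1 h2
    rw [cnt_apply_perm, cnt, cnt, ← Finset.card_union_of_disjoint]
    · congr 1
      ext k
      simp only [Finset.mem_union, Finset.mem_filter, Finset.mem_univ, true_and, Fin.val_fin_lt,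
        Nat.lt_succ_iff, Fin.val_fin_le]
      constructor
      · rintro ⟨h3, h4⟩
        rcases hX k with h5 | h5
        · exact Or.inl ⟨(monUL i k h1 h2 h5 h4).1 h3, h5⟩
        · refine Or.inr ⟨?_, h5⟩
          by_contra h6
          simp [lowR' k h5 (not_le.1 h6)] at h4
      · rintro (⟨h3, h4⟩ | ⟨h3, h4⟩)
        · have h5 : valLabel σ (σ k) = true := by
            rcases hY (σ k) with h5 | h5
            · exact h5
            · exact absurd (sepU i k h1 h2 h4 h5) h3.not_gt
          exact ⟨(monUL i k h1 h2 h4 h5).2 h3, h5⟩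
        · exact ⟨sepL k i h4 h3 h1 h2, lowL' k h4 h3⟩
    · rw [Finset.disjoint_left]
      intro k hk hk'
      simp only [Finset.mem_filter] at hk hk'
      simp [hk.2.2] at hk'
  -- Likewise the values on the right sides below an upper right point come from the upper right
  -- points after it and from all lower right points. These are counts in suffixes, which is how the
  -- total `n` enters.
  have cntR : ∀ i, posLabel σ i = true → valLabel σ (σ i) = false →
      cnt (valLabel σ) false (σ i) + cnt (posLabel σ) true i + cnt (posLabel σ) false (z + 1) + 1
        = n := by
    intro i h1 h2
    have e1 := card_filter_Ioo_eq (posLabel σ) true (p := i + 1) (q := n) i.2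
    have e2 := card_filter_Ioo_eq (posLabel σ) false (p := z + 1) (q := n) z.2
    have e3 := cnt_add_cnt (posLabel σ) le_rfl
    have e4 := cnt_succ_of_eq (posLabel σ) true h1
    rw [cnt_apply_perm]
    have : (Finset.univ.filter fun k : Fin n => (σ k : ℕ) < σ i ∧ valLabel σ (σ k) = false)
      = (Finset.univ.filter fun k : Fin n =>
          ((i : ℕ) + 1 ≤ (k : ℕ) ∧ (k : ℕ) < n) ∧ posLabel σ k = true) ∪
        (Finset.univ.filter fun k : Fin n =>
          ((z : ℕ) + 1 ≤ (k : ℕ) ∧ (k : ℕ) < n) ∧ posLabel σ k = false) := by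
      ext k
      simp only [Finset.mem_union, Finset.mem_filter, Finset.mem_univ, true_and, Fin.val_fin_lt,
        Nat.succ_le_iff, k.2, and_true]
      constructor
      · rintro ⟨h3, h4⟩
        rcases hX k with h5 | h5
        · exact Or.inl ⟨(monUR i k h1 h2 h5 h4).1 h3, h5⟩
        · refine Or.inr ⟨?_, h5⟩
          by_contra h6
          simp [lowL' k h5 (not_lt.1 h6)] at h4
      · rintro (⟨h3, h4⟩ | ⟨h3, h4⟩)
        · have h5 : valLabel σ (σ k) = false := by
            rcases hY (σ k) with h5 | h5
            · exact absurd (sepU k i h4 h5 h1 h2) h3.not_gt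
            · exact h5
          exact ⟨(monUR i k h1 h2 h4 h5).2 h3, h5⟩
        · exact ⟨sepR k i h4 h3 h1 h2, lowR' k h4 h3⟩
    rw [this, Finset.card_union_of_disjoint]
    · omega
    · rw [Finset.disjoint_left]
      intro k hk hk'
      simp only [Finset.mem_filter] at hk hk'
      simp [hk.2.2] at hk'
  refine ⟨fun i h1 h2 => ⟨lowL' i h1 h2, ?_⟩, fun i h1 h2 => ⟨lowR' i h1 h2, ?_⟩,
    fun i h1 h2 => ?_, fun i h1 h2 => ?_⟩
  · rw [← card_filter_Ioo_eq (posLabel σ) false (p := i + 1) (q := z + 1)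
      (Nat.succ_le_succ (Fin.le_def.1 h2)), cnt_apply_perm]
    congr 2
    ext k
    simp only [Finset.mem_filter, Finset.mem_univ, true_and, Fin.val_fin_lt, Nat.succ_le_iff,
      Nat.lt_succ_iff, Fin.val_fin_le]
    constructor
    · rintro ⟨h3, h4⟩
      rcases hX k with h5 | h5
      · exact absurd (sepL i k h1 h2 h5 h4) h3.not_gt
      · have h6 : k ≤ z := by
          by_contra h6
          simp [lowR' k h5 (not_le.1 h6)] at h4
        exact ⟨⟨(monL i k h1 h2 h5 h6).1 h3, h6⟩, h5⟩
    · rintro ⟨⟨h3, h4⟩, h5⟩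
      exact ⟨(monL i k h1 h2 h5 h4).2 h3, lowL' k h5 h4⟩
  · rw [← card_filter_Ioo_eq (posLabel σ) false (p := z + 1) (q := i)
      (Nat.succ_le_of_lt (Fin.lt_def.1 h2)), cnt_apply_perm]
    congr 2
    ext k
    simp only [Finset.mem_filter, Finset.mem_univ, true_and, Fin.val_fin_lt, Nat.succ_le_iff]
    constructor
    · rintro ⟨h3, h4⟩
      rcases hX k with h5 | h5
      · exact absurd (sepR i k h1 h2 h5 h4) h3.not_gt
      · have h6 : z < k := by
          by_contra h6
          simp [lowL' k h5 (not_lt.1 h6)] at h4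
        exact ⟨⟨h6, (monR i k h1 h2 h5 h6).1 h3⟩, h5⟩
    · rintro ⟨⟨h3, h4⟩, h5⟩
      exact ⟨(monR i k h1 h2 h5 h3).2 h4, lowR' k h5 h3⟩
  -- The threshold tells left from right on the upper boundary: with the opposite letter of the
  -- value, the rank formula contradicts the inequality assumed on the counts.
  · rcases hY (σ i) with h3 | h3
    · exact ⟨h3, cntL i h1 h3⟩
    · have e1 := cntR i h1 h3
      have e2 := cnt_lt_cnt (valLabel σ) false h3 (σ i).2
      have e3 := cnt_add_cnt (valLabel σ) le_rfl
      omega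
  · rcases hY (σ i) with h3 | h3
    · have e1 := cntL i h1 h3
      have e2 := cnt_lt_cnt (valLabel σ) true h3 (σ i).2
      omega
    · exact ⟨h3, cntR i h1 h3⟩

end Labels

/-! ### Reconstructing a permutation from its labels. -/

section Decoding

variable {n : ℕ} {X Y : Fin n → Bool} {z : Fin n}

/-- The values with letter `true` must be filled by the lower left positions and by an initial run
of the letters `true` of `X`. The hypotheses say that the length of this run lies between `0` and
the number of letters `true` available. -/
theorem exists_isDecoding (h1 : cnt X false ((z : ℕ) + 1) ≤ cnt Y true n)
    (h2 : cnt Y true n ≤ cnt X true n + cnt X false ((z : ℕ) + 1)) :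
    ∃ σ, IsDecoding X Y z σ := by
  have hXn := cnt_add_cnt X le_rfl
  have hYn := cnt_add_cnt Y le_rfl
  have key : ∀ i : Fin n, ∃ v : Fin n,
      (X i = false → i ≤ z → Y v = true ∧
        cnt Y true v + cnt X false ((i : ℕ) + 1) = cnt X false ((z : ℕ) + 1)) ∧
      (X i = false → z < i → Y v = false ∧
        cnt Y false v + cnt X false ((z : ℕ) + 1) = cnt X false i) ∧
      (X i = true → cnt X true i + cnt X false ((z : ℕ) + 1) < cnt Y true n →
        Y v = true ∧ cnt Y true v = cnt X true i + cnt X false ((z : ℕ) + 1)) ∧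
      (X i = true → cnt Y true n ≤ cnt X true i + cnt X false ((z : ℕ) + 1) →
        Y v = false ∧
        cnt Y false v + cnt X true i + cnt X false ((z : ℕ) + 1) + 1 = n) := by
    intro i
    rcases hX : X i with _ | _
    · have e := cnt_succ_of_eq X false hX
      rcases le_or_gt i z with h | h
      · have e1 := cnt_mono X false (Nat.succ_le_succ (Fin.le_def.1 h))
        simp only [Nat.succ_eq_add_one] at e1
        obtain ⟨v, hv, hv'⟩ := exists_cnt_eq Y true le_rfl
          (m := cnt X false ((z : ℕ) + 1) - cnt X false ((i : ℕ) + 1)) (by omega)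
        exact ⟨v, fun _ _ => ⟨hv, by omega⟩, fun _ h' => absurd h h'.not_ge, by simp, by simp⟩
      · have e1 := cnt_mono X false (Nat.succ_le_of_lt (Fin.lt_def.1 h))
        have e2 := cnt_lt_cnt X false hX i.2
        simp only [Nat.succ_eq_add_one] at e1
        obtain ⟨v, hv, hv'⟩ := exists_cnt_eq Y false le_rfl
          (m := cnt X false i - cnt X false ((z : ℕ) + 1)) (by omega)
        exact ⟨v, fun _ h' => absurd h h'.not_gt, fun _ _ => ⟨hv, by omega⟩, by simp, by simp⟩
    · have e := cnt_lt_cnt X true hX i.2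
      have e1 := cnt_mono X false (Nat.succ_le_of_lt z.2)
      simp only [Nat.succ_eq_add_one] at e1
      rcases lt_or_ge (cnt X true i + cnt X false ((z : ℕ) + 1)) (cnt Y true n) with h | h
      · obtain ⟨v, hv, hv'⟩ := exists_cnt_eq Y true le_rfl h
        exact ⟨v, by simp, by simp, fun _ _ => ⟨hv, hv'⟩, fun _ h' => absurd h h'.not_gt⟩
      · obtain ⟨v, hv, hv'⟩ := exists_cnt_eq Y false le_rfl
          (m := n - 1 - cnt X true i - cnt X false ((z : ℕ) + 1)) (by omega)
        exact ⟨v, by simp, by simp, fun _ h' => absurd h h'.not_ge, fun _ _ => ⟨hv, by omega⟩⟩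
  choose f hf1 hf2 hf3 hf4 using key
  have hinj : Function.Injective f := by
    -- A lower and an upper position never share a value: either the letters of their values differ,
    -- or the ranks on the lower side stay strictly below those on the upper side.
    have aux : ∀ i j, f i = f j → X i = false → X j = true → False := by
      intro i j hij hi hj
      have e := cnt_succ_of_eq X false hi
      have e1 := cnt_lt_cnt X false hi i.2
      have e2 := cnt_lt_cnt X true hj j.2
      rcases le_or_gt i z with h | h <;>
      rcases lt_or_ge (cnt X true j + cnt X false ((z : ℕ) + 1)) (cnt Y true n) with h' | h'
      · have a1 := hf1 i hi h
        have a2 := hf3 j hj h'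
        rw [hij] at a1
        omega
      · have a1 := hf1 i hi h
        have a2 := hf4 j hj h'
        rw [hij, a2.1] at a1
        simp at a1
      · have a1 := hf2 i hi h
        have a2 := hf3 j hj h'
        rw [hij, a2.1] at a1
        simp at a1
      · have a1 := hf2 i hi h
        have a2 := hf4 j hj h'
        rw [hij] at a1
        omega
    intro i j hij
    rcases hi : X i with _ | _ <;> rcases hj : X j with _ | _
    · have e := cnt_succ_of_eq X false hi
      have e' := cnt_succ_of_eq X false hj
      refine eq_of_cnt_eq X false hi hj ?_
      rcases le_or_gt i z with h | h <;> rcases le_or_gt j z with h' | h'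
      · have a1 := hf1 i hi h
        have a2 := hf1 j hj h'
        rw [hij] at a1
        omega
      · have a1 := hf1 i hi h
        have a2 := hf2 j hj h'
        rw [hij, a2.1] at a1
        simp at a1
      · have a1 := hf2 i hi h
        have a2 := hf1 j hj h'
        rw [hij, a2.1] at a1
        simp at a1
      · have a1 := hf2 i hi h
        have a2 := hf2 j hj h'
        rw [hij] at a1
        omega
    · exact (aux i j hij hi hj).elim
    · exact (aux j i hij.symm hj hi).elim
    · refine eq_of_cnt_eq X true hi hj ?_
      rcases lt_or_ge (cnt X true i + cnt X false ((z : ℕ) + 1)) (cnt Y true n) with h | h <;>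
      rcases lt_or_ge (cnt X true j + cnt X false ((z : ℕ) + 1)) (cnt Y true n) with h' | h'
      · have a1 := hf3 i hi h
        have a2 := hf3 j hj h'
        rw [hij] at a1
        omega
      · have a1 := hf3 i hi h
        have a2 := hf4 j hj h'
        rw [hij, a2.1] at a1
        simp at a1
      · have a1 := hf4 i hi h
        have a2 := hf3 j hj h'
        rw [hij, a2.1] at a1
        simp at a1
      · have a1 := hf4 i hi h
        have a2 := hf4 j hj h'
        rw [hij] at a1
        omega
  exact ⟨Equiv.ofBijective f (Finite.injective_iff_bijective.1 hinj),
    ⟨fun i => hf1 i, fun i => hf2 i, fun i => hf3 i, fun i => hf4 i⟩⟩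

/-- In every prefix of the word the two letters are equally frequent up to `δ`. -/
def IsBalanced (δ : ℕ) (X : Fin n → Bool) : Prop :=
  ∀ k ≤ n, 2 * cnt X true k ≤ k + δ ∧ k ≤ 2 * cnt X true k + δ

theorem IsBalanced.bound {δ : ℕ} (h : IsBalanced δ X) (b : Bool) {k : ℕ} (hk : k ≤ n) :
    2 * cnt X b k ≤ k + δ ∧ k ≤ 2 * cnt X b k + δ := by
  have h1 := h k hk
  cases b
  · have h2 := cnt_add_cnt X hk
    omega
  · exact h1

namespace IsDecoding

variable {σ : Equiv.Perm (Fin n)}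

/-- The rank equation involves three prefix counts, and twice each count is the prefix length up to
`δ`. Doubling the equation gives the equation of the side with error `3 * δ`; the other three sides
are treated alike. -/
theorem lowLeft_bound (h : IsDecoding X Y z σ) {δ : ℕ} (hX : IsBalanced δ X)
    (hY : IsBalanced δ Y) {i : Fin n} (hi : X i = false) (hiz : i ≤ z) :
    (σ i : ℕ) + i ≤ z + 3 * δ ∧ (z : ℕ) ≤ σ i + i + 3 * δ := by
  have h1 := (h.lowLeft i hi hiz).2
  have h2 := hX.bound false (k := (i : ℕ) + 1) i.2
  have h3 := hX.bound false (k := (z : ℕ) + 1) z.2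
  have h4 := hY.bound true (σ i).2.le
  omega

theorem lowRight_bound (h : IsDecoding X Y z σ) {δ : ℕ} (hX : IsBalanced δ X)
    (hY : IsBalanced δ Y) {i : Fin n} (hi : X i = false) (hiz : z < i) :
    (σ i : ℕ) + z + 1 ≤ i + 3 * δ ∧ (i : ℕ) ≤ σ i + z + 1 + 3 * δ := by
  have h1 := (h.lowRight i hi hiz).2
  have h2 := hX.bound false i.2.le
  have h3 := hX.bound false (k := (z : ℕ) + 1) z.2
  have h4 := hY.bound false (σ i).2.le
  omega

theorem upLeft_bound (h : IsDecoding X Y z σ) {δ : ℕ} (hX : IsBalanced δ X)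
    (hY : IsBalanced δ Y) {i : Fin n} (hi : X i = true)
    (hiz : cnt X true i + cnt X false ((z : ℕ) + 1) < cnt Y true n) :
    (σ i : ℕ) ≤ i + z + 1 + 3 * δ ∧ (i : ℕ) + z + 1 ≤ σ i + 3 * δ := by
  have h1 := (h.upLeft i hi hiz).2
  have h2 := hX.bound true i.2.le
  have h3 := hX.bound false (k := (z : ℕ) + 1) z.2
  have h4 := hY.bound true (σ i).2.le
  omega

theorem upRight_bound (h : IsDecoding X Y z σ) {δ : ℕ} (hX : IsBalanced δ X)
    (hY : IsBalanced δ Y) {i : Fin n} (hi : X i = true)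
    (hiz : cnt Y true n ≤ cnt X true i + cnt X false ((z : ℕ) + 1)) :
    (σ i : ℕ) + i + z + 3 ≤ 2 * n + 3 * δ ∧ 2 * n ≤ (σ i : ℕ) + i + z + 3 + 3 * δ := by
  have h1 := (h.upRight i hi hiz).2
  have h2 := hX.bound true i.2.le
  have h3 := hX.bound false (k := (z : ℕ) + 1) z.2
  have h4 := hY.bound false (σ i).2.le
  omega

/-- Values with the same letter of `Y` are ordered as their ranks. So points on the same side, or on
the lower and upper sides of the same half, are compared exactly, without any balance assumption. -/
theorem lowLeft_lt_lowLeft (h : IsDecoding X Y z σ) {i j : Fin n} (hi : X i = false)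
    (hj : X j = false) (hjz : j ≤ z) (hij : i < j) : σ j < σ i := by
  have h1 := (h.lowLeft i hi (hij.le.trans hjz)).2
  have h2 := (h.lowLeft j hj hjz).2
  have h3 := cnt_lt_cnt X false hi (Fin.lt_def.1 hij)
  have h4 := cnt_succ_of_eq X false hi
  have h5 := cnt_succ_of_eq X false hj
  exact Fin.lt_def.2 (lt_of_cnt_lt_cnt Y true (by omega))

theorem lowRight_lt_lowRight (h : IsDecoding X Y z σ) {i j : Fin n} (hi : X i = false)
    (hj : X j = false) (hiz : z < i) (hij : i < j) : σ i < σ j := by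
  have h1 := (h.lowRight i hi hiz).2
  have h2 := (h.lowRight j hj (hiz.trans hij)).2
  have h3 := cnt_lt_cnt X false hi (Fin.lt_def.1 hij)
  exact Fin.lt_def.2 (lt_of_cnt_lt_cnt Y false (by omega))

theorem upLeft_lt_upLeft (h : IsDecoding X Y z σ) {i j : Fin n} (hi : X i = true)
    (hj : X j = true) (hjz : cnt X true j + cnt X false ((z : ℕ) + 1) < cnt Y true n)
    (hij : i < j) : σ i < σ j := by
  have h3 := cnt_lt_cnt X true hi (Fin.lt_def.1 hij)
  have h1 := (h.upLeft i hi (by omega)).2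
  have h2 := (h.upLeft j hj hjz).2
  exact Fin.lt_def.2 (lt_of_cnt_lt_cnt Y true (by omega))

theorem upRight_lt_upRight (h : IsDecoding X Y z σ) {i j : Fin n} (hi : X i = true)
    (hj : X j = true) (hiz : cnt Y true n ≤ cnt X true i + cnt X false ((z : ℕ) + 1))
    (hij : i < j) : σ j < σ i := by
  have h3 := cnt_lt_cnt X true hi (Fin.lt_def.1 hij)
  have h1 := (h.upRight i hi hiz).2
  have h2 := (h.upRight j hj (by omega)).2
  exact Fin.lt_def.2 (lt_of_cnt_lt_cnt Y false (by omega))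

theorem lowLeft_lt_upLeft (h : IsDecoding X Y z σ) {i j : Fin n} (hi : X i = false)
    (hiz : i ≤ z) (hj : X j = true)
    (hjz : cnt X true j + cnt X false ((z : ℕ) + 1) < cnt Y true n) : σ i < σ j := by
  have h1 := (h.lowLeft i hi hiz).2
  have h2 := (h.upLeft j hj hjz).2
  have h4 := cnt_succ_of_eq X false hi
  exact Fin.lt_def.2 (lt_of_cnt_lt_cnt Y true (by omega))

theorem lowRight_lt_upRight (h : IsDecoding X Y z σ) {i j : Fin n} (hi : X i = false)
    (hiz : z < i) (hj : X j = true)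
    (hjz : cnt Y true n ≤ cnt X true j + cnt X false ((z : ℕ) + 1)) : σ i < σ j := by
  have h1 := (h.lowRight i hi hiz).2
  have h2 := (h.upRight j hj hjz).2
  have h3 := cnt_lt_cnt X false hi i.2
  have h4 := cnt_lt_cnt X true hj j.2
  have h5 := cnt_add_cnt X le_rfl
  exact Fin.lt_def.2 (lt_of_cnt_lt_cnt Y false (by omega))

theorem apply_min (h : IsDecoding X Y z σ) (hz : X z = false)
    (hY0 : ∀ j : Fin n, (j : ℕ) = 0 → Y j = true) : (σ z : ℕ) = 0 := by
  have h1 := h.lowLeft z hz le_rfl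
  have hn : 0 < n := z.pos
  have := eq_of_cnt_eq Y true h1.1 (hY0 ⟨0, hn⟩ rfl) (by rw [cnt_zero]; omega)
  rw [this]

/-! ### Decodings of balanced words are square permutations with the prescribed labels. -/

section Balanced

set_option linter.unusedSectionVars false

variable {δ : ℕ} (h : IsDecoding X Y z σ) (hX : IsBalanced δ X) (hY : IsBalanced δ Y)
  (hz1 : 6 * δ + 6 ≤ (z : ℕ)) (hz2 : (z : ℕ) + 6 * δ + 6 ≤ n)

include h hX hY hz1 hz2

/-- Only points on opposite sides of the rectangle need the approximate bounds, here and in the next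
three lemmas. In the order considered, their heights differ by at least about `2z` or `2(n - z)`,
and the margin `6 * δ + 6` makes this exceed the two errors `3 * δ`. -/
theorem lrMin_of_lowLeft {i : Fin n} (hi : X i = false) (hiz : i ≤ z) : IsLRMin σ i := by
  intro j hj
  rcases hj' : X j with _ | _
  · exact h.lowLeft_lt_lowLeft hj' hi hiz hj
  · rcases lt_or_ge (cnt X true j + cnt X false ((z : ℕ) + 1)) (cnt Y true n) with h' | h'
    · exact h.lowLeft_lt_upLeft hi hiz hj' h'
    · have h1 := h.lowLeft_bound hX hY hi hiz
      have h2 := h.upRight_bound hX hY hj' h'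
      rw [Fin.lt_def] at hj ⊢
      omega

theorem rlMin_of_lowRight {i : Fin n} (hi : X i = false) (hiz : z < i) : IsRLMin σ i := by
  intro j hj
  rcases hj' : X j with _ | _
  · exact h.lowRight_lt_lowRight hi hj' hiz hj
  · rcases lt_or_ge (cnt X true j + cnt X false ((z : ℕ) + 1)) (cnt Y true n) with h' | h'
    · have h1 := h.lowRight_bound hX hY hi hiz
      have h2 := h.upLeft_bound hX hY hj' h'
      rw [Fin.lt_def] at hj ⊢
      omega
    · exact h.lowRight_lt_upRight hi hiz hj' h'

theorem lrMax_of_upLeft {i : Fin n} (hi : X i = true)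
    (hiz : cnt X true i + cnt X false ((z : ℕ) + 1) < cnt Y true n) : IsLRMax σ i := by
  intro j hj
  rcases hj' : X j with _ | _
  · rcases le_or_gt j z with h' | h'
    · exact h.lowLeft_lt_upLeft hj' h' hi hiz
    · have h1 := h.lowRight_bound hX hY hj' h'
      have h2 := h.upLeft_bound hX hY hi hiz
      rw [Fin.lt_def] at hj ⊢
      omega
  · exact h.upLeft_lt_upLeft hj' hi hiz hj

theorem rlMax_of_upRight {i : Fin n} (hi : X i = true)
    (hiz : cnt Y true n ≤ cnt X true i + cnt X false ((z : ℕ) + 1)) : IsRLMax σ i := by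
  intro j hj
  rcases hj' : X j with _ | _
  · rcases le_or_gt j z with h' | h'
    · have h1 := h.lowLeft_bound hX hY hj' h'
      have h2 := h.upRight_bound hX hY hi hiz
      rw [Fin.lt_def] at hj ⊢
      omega
    · exact h.lowRight_lt_upRight hj' h' hi hiz
  · exact h.upRight_lt_upRight hi hj' hiz hj

theorem isRecord (i : Fin n) : IsRecord σ i := by
  rcases hi : X i with _ | _
  · rcases le_or_gt i z with h' | h'
    · exact Or.inr (Or.inl (h.lrMin_of_lowLeft hX hY hz1 hz2 hi h'))
    · exact Or.inr (Or.inr (Or.inr (h.rlMin_of_lowRight hX hY hz1 hz2 hi h')))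
  · rcases lt_or_ge (cnt X true i + cnt X false ((z : ℕ) + 1)) (cnt Y true n) with h' | h'
    · exact Or.inl (h.lrMax_of_upLeft hX hY hz1 hz2 hi h')
    · exact Or.inr (Or.inr (Or.inl (h.rlMax_of_upRight hX hY hz1 hz2 hi h')))

theorem not_lrMax_of_low {i : Fin n} (hi : X i = false)
    (hX0 : ∀ j : Fin n, (j : ℕ) = 0 → X j = true) : ¬ IsLRMax σ i := by
  intro hmax
  have hn : 0 < n := z.pos
  have hi0 : 0 < (i : ℕ) := by
    refine Nat.pos_of_ne_zero fun h' => ?_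
    simp [hX0 i h'] at hi
  have hu0 := hX0 ⟨0, hn⟩ rfl
  rcases le_or_gt i z with h' | h'
  · have h0 : cnt X true 0 = 0 := cnt_zero X true
    have := hmax ⟨0, hn⟩ (Fin.lt_def.2 hi0)
    refine this.not_gt (h.lowLeft_lt_upLeft hi h' hu0 ?_)
    have h1 := hX.bound false (k := (z : ℕ) + 1) z.2
    have h2 := hY.bound true le_rfl
    simp only [h0]
    omega
  · have hpos : 0 < cnt X true i := by
      have := cnt_lt_cnt X true hu0 (k := i) hi0
      omega
    -- The last upper position before `i` lies above the lower right point at `i`. Its rank is known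
    -- from the prefix at `i`, so its height can be estimated without knowing where `j` is.
    obtain ⟨j, hj, hj'⟩ := exists_cnt_eq X true i.2.le (m := cnt X true i - 1) (by omega)
    have hji : (j : ℕ) < i := lt_of_cnt_lt_cnt X true (by omega)
    refine (hmax j (Fin.lt_def.2 hji)).not_gt ?_
    rcases lt_or_ge (cnt X true j + cnt X false ((z : ℕ) + 1)) (cnt Y true n) with h'' | h''
    · have h1 := h.lowRight_bound hX hY hi h'
      have h2 := (h.upLeft j hj h'').2
      have h3 := hX.bound true i.2.le
      have h4 := hX.bound false (k := (z : ℕ) + 1) z.2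
      have h5 := hY.bound true (σ j).2.le
      rw [Fin.lt_def]
      omega
    · exact h.lowRight_lt_upRight hi h' hj h''

theorem not_rlMax_of_low {i : Fin n} (hi : X i = false)
    (hXn : ∀ j : Fin n, (j : ℕ) + 1 = n → X j = true) : ¬ IsRLMax σ i := by
  intro hmax
  have hn : 0 < n := z.pos
  have hin : (i : ℕ) + 1 < n := by
    refine lt_of_le_of_ne i.2 fun h' => ?_
    simp [hXn i h'] at hi
  have hun := hXn ⟨n - 1, by omega⟩ (Nat.sub_add_cancel hn)
  rcases le_or_gt i z with h' | h'
  · have hpos : cnt X true i < cnt X true n :=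
      lt_of_le_of_lt (cnt_mono X true (show (i : ℕ) ≤ n - 1 by omega))
        (cnt_lt_cnt X true hun (by simp only; omega))
    -- The witness is the first upper position after `i`, whose rank is again read off at `i`. For a
    -- lower right point the last position serves instead.
    obtain ⟨j, hj, hj'⟩ := exists_cnt_eq X true le_rfl hpos
    have hij : (i : ℕ) < j := by
      have e5 : (j : ℕ) ≠ i := fun e => by
        rw [Fin.ext e, hi] at hj
        simp at hj
      by_contra hc
      have : (j : ℕ) < i := by omega
      have := cnt_lt_cnt X true hj this
      omega
    refine (hmax j (Fin.lt_def.2 hij)).not_gt ?_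
    rcases lt_or_ge (cnt X true j + cnt X false ((z : ℕ) + 1)) (cnt Y true n) with h'' | h''
    · exact h.lowLeft_lt_upLeft hi h' hj h''
    · have h1 := h.lowLeft_bound hX hY hi h'
      have h2 := (h.upRight j hj h'').2
      have h3 := hX.bound true i.2.le
      have h4 := hX.bound false (k := (z : ℕ) + 1) z.2
      have h5 := hY.bound false (σ j).2.le
      rw [Fin.lt_def]
      omega
  · refine (hmax ⟨n - 1, by omega⟩ (Fin.lt_def.2 (by simp only; omega))).not_gt ?_
    refine h.lowRight_lt_upRight hi h' hun ?_
    have h1 := hX.bound true (k := n - 1) (by omega)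
    have h2 := hY.bound true le_rfl
    have h3 := hX.bound false (k := (z : ℕ) + 1) z.2
    simp only
    omega

theorem posLabel_eq (hX0 : ∀ j : Fin n, (j : ℕ) = 0 → X j = true)
    (hXn : ∀ j : Fin n, (j : ℕ) + 1 = n → X j = true) : posLabel σ = X := by
  funext i
  rcases hi : X i with _ | _
  · rw [posLabel_eq_false]
    exact ⟨h.not_lrMax_of_low hX hY hz1 hz2 hi hX0, h.not_rlMax_of_low hX hY hz1 hz2 hi hXn⟩
  · rw [posLabel_eq_true]
    rcases lt_or_ge (cnt X true i + cnt X false ((z : ℕ) + 1)) (cnt Y true n) with h' | h'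
    · exact Or.inl (h.lrMax_of_upLeft hX hY hz1 hz2 hi h')
    · exact Or.inr (h.rlMax_of_upRight hX hY hz1 hz2 hi h')

theorem valLabel_eq (hz : X z = false) (hX0 : ∀ j : Fin n, (j : ℕ) = 0 → X j = true)
    (hXn : ∀ j : Fin n, (j : ℕ) + 1 = n → X j = true)
    (hY0 : ∀ j : Fin n, (j : ℕ) = 0 → Y j = true)
    (hYn : ∀ j : Fin n, (j : ℕ) + 1 = n → Y j = false) : valLabel σ = Y := by
  funext j
  obtain ⟨i, rfl⟩ := σ.surjective j
  rcases hi : X i with _ | _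
  · rcases le_or_gt i z with h' | h'
    · rw [(h.lowLeft i hi h').1, valLabel_eq_true]
      exact ⟨h.not_rlMax_of_low hX hY hz1 hz2 hi hXn,
        Or.inr (h.lrMin_of_lowLeft hX hY hz1 hz2 hi h')⟩
    · rw [(h.lowRight i hi h').1, valLabel_eq_false]
      refine Or.inr ⟨h.not_lrMax_of_low hX hY hz1 hz2 hi hX0, fun hmin => ?_⟩
      -- The point at `z` has value `0` and lies to the left of `i`.
      have h1 := hmin z h'
      rw [Fin.lt_def, h.apply_min hz hY0] at h1
      omega
  · rcases lt_or_ge (cnt X true i + cnt X false ((z : ℕ) + 1)) (cnt Y true n) with h' | h'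
    · have hYi := (h.upLeft i hi h').1
      rw [hYi, valLabel_eq_true]
      refine ⟨fun hmax => ?_, Or.inl (h.lrMax_of_upLeft hX hY hz1 hz2 hi h')⟩
      have hn : 0 < n := z.pos
      -- The largest value has letter `false` and is too high for the lower right side, so it sits
      -- on the upper right side. Its position is therefore to the right of `i`, which prevents a
      -- right-to-left maximum at `i`.
      obtain ⟨m, hm⟩ := σ.surjective ⟨n - 1, by omega⟩
      have hYm : Y (σ m) = false := hYn _ (by rw [hm]; simp only; omega)
      have hXm : X m = true := by
        by_contra hc
        rw [Bool.not_eq_true] at hc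
        rcases le_or_gt m z with h2 | h2
        · rw [(h.lowLeft m hc h2).1] at hYm
          simp at hYm
        · have h3 := h.lowRight_bound hX hY hc h2
          rw [hm] at h3
          have := m.2
          simp only at h3
          omega
      have hmz : cnt Y true n ≤ cnt X true m + cnt X false ((z : ℕ) + 1) := by
        by_contra hc
        rw [(h.upLeft m hXm (not_le.1 hc)).1] at hYm
        simp at hYm
      have him : i < m := Fin.lt_def.2 (lt_of_cnt_lt_cnt X true (by omega))
      have h4 := hmax m him
      rw [hm, Fin.lt_def] at h4
      have := (σ i).2
      simp only at h4
      omega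
    · rw [(h.upRight i hi h').1, valLabel_eq_false]
      exact Or.inl (h.rlMax_of_upRight hX hY hz1 hz2 hi h')

end Balanced

end IsDecoding

end Decoding

/-! ### Unbalanced words are rare -/

section Moments

variable {n : ℕ}

/-- The excess of the letter `true` among the first `k` letters. -/
def excess (X : Fin n → Bool) (k : ℕ) : ℤ := 2 * cnt X true k - k

theorem excess_succ (X : Fin n → Bool) (i : Fin n) :
    excess X ((i : ℕ) + 1) = excess X i + if X i then 1 else -1 := by
  unfold excess
  rw [cnt_succ]
  split_ifs <;> push_cast <;> ring

theorem excess_update (X : Fin n → Bool) (i : Fin n) (b : Bool) :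
    excess (Function.update X i b) i = excess X i := by
  unfold excess cnt
  congr 4
  ext j
  simp only [Finset.mem_filter, Finset.mem_univ, true_and]
  refine and_congr_right fun h => ?_
  rw [Function.update_of_ne (fun e => by rw [e] at h; exact lt_irrefl _ h)]

/-- Flipping the letter at `i` changes the sign but not the excess at `i`, which only sees earlier
letters. This is the independence of the steps of a random walk. -/
theorem sum_sign_mul_eq_zero (i : Fin n) (g : ℤ → ℤ) :
    ∑ X : Fin n → Bool, (if X i then 1 else -1) * g (excess X i) = 0 := by
  have hinv : Function.Involutive fun X : Fin n → Bool => Function.update X i (!X i) := fun X => by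
    simp
  have h := Equiv.sum_comp hinv.toPerm
    fun X : Fin n → Bool => (if X i then 1 else -1) * g (excess X i)
  simp only [Function.Involutive.coe_toPerm, excess_update, Function.update_self] at h
  have h2 : ∑ X : Fin n → Bool, (if (!X i) then 1 else -1) * g (excess X i)
      = - ∑ X : Fin n → Bool, (if X i then 1 else -1) * g (excess X i) := by
    rw [← Finset.sum_neg_distrib]
    refine Finset.sum_congr rfl fun X _ => ?_
    cases X i <;> simp
  omega

theorem sum_excess_sq {k : ℕ} (hk : k ≤ n) :
    ∑ X : Fin n → Bool, excess X k ^ 2 = k * 2 ^ n := by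
  induction k with
  | zero => simp [excess, cnt_zero]
  | succ k ih =>
    have h1 : ∀ X : Fin n → Bool, excess X (k + 1) ^ 2 = excess X k ^ 2
        + 2 * ((if X ⟨k, hk⟩ then 1 else -1) * excess X k) + 1 := fun X => by
      have := excess_succ X ⟨k, hk⟩
      simp only at this
      rw [this]
      split_ifs <;> ring
    have h2 := sum_sign_mul_eq_zero ⟨k, hk⟩ fun x => x
    simp only at h2
    rw [Finset.sum_congr rfl fun X _ => h1 X, Finset.sum_add_distrib, Finset.sum_add_distrib,
      ← Finset.mul_sum, h2, ih (by omega)]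
    simp
    ring

/-- In the expansion of the fourth power after one more step the odd terms cancel, and `3k² + 6k + 1
≤ 3(k + 1)²` closes the induction. -/
theorem sum_excess_pow_four_le {k : ℕ} (hk : k ≤ n) :
    ∑ X : Fin n → Bool, excess X k ^ 4 ≤ 3 * k ^ 2 * 2 ^ n := by
  induction k with
  | zero => simp [excess, cnt_zero]
  | succ k ih =>
    have h1 : ∀ X : Fin n → Bool, excess X (k + 1) ^ 4 = excess X k ^ 4
        + 4 * ((if X ⟨k, hk⟩ then 1 else -1) * excess X k ^ 3)
        + 6 * excess X k ^ 2
        + 4 * ((if X ⟨k, hk⟩ then 1 else -1) * excess X k) + 1 := fun X => by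
      have := excess_succ X ⟨k, hk⟩
      simp only at this
      rw [this]
      split_ifs <;> ring
    have h2 := sum_sign_mul_eq_zero ⟨k, hk⟩ fun x => x
    have h3 := sum_sign_mul_eq_zero ⟨k, hk⟩ fun x => x ^ 3
    simp only at h2 h3
    rw [Finset.sum_congr rfl fun X _ => h1 X, Finset.sum_add_distrib, Finset.sum_add_distrib,
      Finset.sum_add_distrib, Finset.sum_add_distrib, ← Finset.mul_sum, ← Finset.mul_sum,
      ← Finset.mul_sum, h2, h3, sum_excess_sq (by omega)]
    have h4 := ih (by omega)
    simp only [Finset.sum_const, Finset.card_univ, Fintype.card_pi, Fintype.card_bool,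
      Finset.prod_const, Fintype.card_fin]
    push_cast
    have : (0 : ℤ) ≤ 2 ^ n := by positivity
    simp only [nsmul_eq_mul]
    push_cast
    nlinarith

open Classical in
/-- The words that are not balanced. -/
noncomputable def unbalanced (n δ : ℕ) : Finset (Fin n → Bool) :=
  Finset.univ.filter fun X => ¬ IsBalanced δ X

theorem mem_unbalanced {δ : ℕ} {X : Fin n → Bool} : X ∈ unbalanced n δ ↔ ¬ IsBalanced δ X := by
  simp [unbalanced]

/-- Markov's inequality for the fourth power, with a union bound over the `n + 1` prefixes. Second
moments would only give a proportion of order `n² / δ²`, which is useless for `δ < n`. -/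
theorem card_unbalanced_mul_le (n δ : ℕ) :
    (unbalanced n δ).card * (δ + 1) ^ 4 ≤ (n + 1) * (3 * n ^ 2 * 2 ^ n) := by
  have h1 : ∀ X ∈ unbalanced n δ,
      ((δ : ℤ) + 1) ^ 4 ≤ ∑ k ∈ Finset.range (n + 1), excess X k ^ 4 := by
    intro X hX
    rw [mem_unbalanced, IsBalanced] at hX
    push Not at hX
    obtain ⟨k, hk, hk'⟩ := hX
    have h2 : ((δ : ℤ) + 1) ^ 4 ≤ excess X k ^ 4 := by
      have : (δ : ℤ) + 1 ≤ |excess X k| := by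
        rw [le_abs]
        unfold excess
        by_contra hc
        push Not at hc
        omega
      calc ((δ : ℤ) + 1) ^ 4 ≤ |excess X k| ^ 4 := by gcongr
        _ = excess X k ^ 4 := by rw [show (4 : ℕ) = 2 * 2 from rfl, pow_mul, pow_mul, sq_abs]
    refine h2.trans (Finset.single_le_sum (f := fun k => excess X k ^ 4)
      (fun k _ => by positivity) (Finset.mem_range.2 (by omega)))
  have h2 : ((unbalanced n δ).card : ℤ) * ((δ : ℤ) + 1) ^ 4
      ≤ (n + 1) * (3 * n ^ 2 * 2 ^ n) := by
    calc ((unbalanced n δ).card : ℤ) * ((δ : ℤ) + 1) ^ 4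
        = ∑ _X ∈ unbalanced n δ, ((δ : ℤ) + 1) ^ 4 := by simp
      _ ≤ ∑ X ∈ unbalanced n δ, ∑ k ∈ Finset.range (n + 1), excess X k ^ 4 :=
          Finset.sum_le_sum h1
      _ ≤ ∑ X : Fin n → Bool, ∑ k ∈ Finset.range (n + 1), excess X k ^ 4 :=
          Finset.sum_le_sum_of_subset_of_nonneg (Finset.subset_univ _) fun X _ _ =>
            Finset.sum_nonneg fun k _ => by positivity
      _ = ∑ k ∈ Finset.range (n + 1), ∑ X : Fin n → Bool, excess X k ^ 4 := Finset.sum_comm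
      _ ≤ ∑ k ∈ Finset.range (n + 1), 3 * (n : ℤ) ^ 2 * 2 ^ n := by
          refine Finset.sum_le_sum fun k hk => ?_
          have hk' : k ≤ n := by
            have := Finset.mem_range.1 hk
            omega
          refine (sum_excess_pow_four_le hk').trans ?_
          gcongr
      _ = (n + 1) * (3 * n ^ 2 * 2 ^ n) := by simp
  exact_mod_cast h2

end Moments

/-! ### Counting square permutations with a given position of the minimum -/

section Fibers

variable {n : ℕ}

theorem card_filter_agree (S : Finset (Fin n)) (a : Fin n → Bool) :
    (Finset.univ.filter fun X : Fin n → Bool => ∀ i ∈ S, X i = a i).card = 2 ^ (n - S.card) := by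
  have : (Finset.univ.filter fun X : Fin n → Bool => ∀ i ∈ S, X i = a i)
      = Fintype.piFinset fun i => if i ∈ S then {a i} else Finset.univ := by
    ext X
    simp only [Finset.mem_filter, Finset.mem_univ, true_and, Fintype.mem_piFinset]
    refine forall_congr' fun i => ?_
    split_ifs with h <;> simp [h]
  rw [this, Fintype.card_piFinset]
  have h2 : ∀ i : Fin n, (if i ∈ S then ({a i} : Finset Bool) else Finset.univ).card
      = if i ∈ S then 1 else 2 := fun i => by
    split_ifs <;> simp
  rw [Finset.prod_congr rfl fun i _ => h2 i, Finset.prod_ite]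
  simp only [Finset.prod_const, one_pow, one_mul]
  congr 1
  rw [Finset.filter_not, Finset.card_sdiff_of_subset (Finset.filter_subset _ _)]
  simp

/-- The pairs of words that satisfy the constraints met by the labels of a square permutation
with minimum at the inner position `z`. -/
def admissible (z : Fin n) : Finset ((Fin n → Bool) × (Fin n → Bool)) :=
  (Finset.univ.filter fun X : Fin n → Bool =>
    ∀ i ∈ Finset.univ.filter (fun i : Fin n => (i : ℕ) = 0 ∨ (i : ℕ) + 1 = n ∨ i = z),
      X i = decide (i ≠ z)) ×ˢ
  (Finset.univ.filter fun Y : Fin n → Bool =>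
    ∀ i ∈ Finset.univ.filter (fun i : Fin n => (i : ℕ) = 0 ∨ (i : ℕ) + 1 = n),
      Y i = decide ((i : ℕ) = 0))

/-- The number of admissible pairs. -/
def numAdmissible (n : ℕ) : ℕ := 2 ^ (n - 3) * 2 ^ (n - 2)

theorem card_admissible {z : Fin n} (h0 : 0 < (z : ℕ)) (h1 : (z : ℕ) + 1 < n) :
    (admissible z).card = numAdmissible n := by
  have e1 : Finset.univ.filter (fun i : Fin n => (i : ℕ) = 0 ∨ (i : ℕ) + 1 = n ∨ i = z)
      = {⟨0, by omega⟩, ⟨n - 1, by omega⟩, z} := by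
    ext i
    simp only [Finset.mem_filter, Finset.mem_univ, true_and, Finset.mem_insert,
      Finset.mem_singleton, Fin.ext_iff]
    omega
  have e2 : Finset.univ.filter (fun i : Fin n => (i : ℕ) = 0 ∨ (i : ℕ) + 1 = n)
      = {⟨0, by omega⟩, ⟨n - 1, by omega⟩} := by
    ext i
    simp only [Finset.mem_filter, Finset.mem_univ, true_and, Finset.mem_insert,
      Finset.mem_singleton, Fin.ext_iff]
    omega
  rw [admissible, Finset.card_product, card_filter_agree, card_filter_agree, e1, e2,
    Finset.card_eq_three.2 ⟨_, _, _, ?_, ?_, ?_, rfl⟩, Finset.card_pair, numAdmissible]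
  all_goals
    rw [Ne, Fin.ext_iff]
    simp only
    omega

theorem mem_admissible {z : Fin n} (h0 : 0 < (z : ℕ)) (h1 : (z : ℕ) + 1 < n)
    {X Y : Fin n → Bool} : (X, Y) ∈ admissible z ↔
      ((∀ j : Fin n, (j : ℕ) = 0 → X j = true) ∧ (∀ j : Fin n, (j : ℕ) + 1 = n → X j = true) ∧
        X z = false) ∧
      (∀ j : Fin n, (j : ℕ) = 0 → Y j = true) ∧ ∀ j : Fin n, (j : ℕ) + 1 = n → Y j = false := by
  simp only [admissible, Finset.mem_product, Finset.mem_filter, Finset.mem_univ, true_and]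
  constructor
  · rintro ⟨hX, hY⟩
    refine ⟨⟨fun j hj => ?_, fun j hj => ?_, ?_⟩, fun j hj => ?_, fun j hj => ?_⟩
    · rw [hX j (Or.inl hj), decide_eq_true_eq]
      rintro rfl
      omega
    · rw [hX j (Or.inr (Or.inl hj)), decide_eq_true_eq]
      rintro rfl
      omega
    · rw [hX z (Or.inr (Or.inr rfl))]
      simp
    · rw [hY j (Or.inl hj), decide_eq_true_eq]
      exact hj
    · rw [hY j (Or.inr hj), decide_eq_false_iff_not]
      omega
  · rintro ⟨⟨hX0, hXn, hXz⟩, hY0, hYn⟩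
    refine ⟨?_, ?_⟩
    · rintro j (hj | hj | rfl)
      · rw [hX0 j hj, eq_comm, decide_eq_true_eq]
        rintro rfl
        omega
      · rw [hXn j hj, eq_comm, decide_eq_true_eq]
        rintro rfl
        omega
      · simp [hXz]
    · rintro j (hj | hj)
      · simp [hY0 j hj, hj]
      · rw [hYn j hj, eq_comm, decide_eq_false_iff_not]
        omega

open Classical in
/-- The square permutations with minimum at the position `z`. -/
noncomputable def sqFiber (z : Fin n) : Finset (Equiv.Perm (Fin n)) :=
  Finset.univ.filter fun σ => (∀ i, IsRecord σ i) ∧ (σ z : ℕ) = 0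

theorem mem_sqFiber {z : Fin n} {σ : Equiv.Perm (Fin n)} :
    σ ∈ sqFiber z ↔ (∀ i, IsRecord σ i) ∧ (σ z : ℕ) = 0 := by
  simp [sqFiber]

/-- The two words of labels of a permutation. -/
noncomputable def labels (σ : Equiv.Perm (Fin n)) : (Fin n → Bool) × (Fin n → Bool) :=
  (posLabel σ, valLabel σ)

theorem injOn_labels (z : Fin n) : Set.InjOn labels (sqFiber z : Set (Equiv.Perm (Fin n))) := by
  intro σ hσ τ hτ h
  rw [Finset.mem_coe, mem_sqFiber] at hσ hτ
  have h1 := isDecoding_of_isRecord hσ.1 hσ.2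
  have h2 := isDecoding_of_isRecord hτ.1 hτ.2
  rw [labels, labels, Prod.mk.injEq] at h
  rw [h.1, h.2] at h1
  exact h1.unique h2

/-- The two end positions are maxima for a vacuous reason, while an inner position with value `0` is
a maximum from neither end. The value `0` belongs to a left-to-right minimum and the value `n - 1`
to a right-to-left maximum. -/
theorem labels_mem_admissible {z : Fin n} (h0 : 0 < (z : ℕ)) (h1 : (z : ℕ) + 1 < n)
    {σ : Equiv.Perm (Fin n)} (hz : (σ z : ℕ) = 0) :
    labels σ ∈ admissible z := by
  have hmin : ∀ j, j ≠ z → σ z < σ j := fun j hj => by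
    rw [Fin.lt_def, hz]
    refine Nat.pos_of_ne_zero fun h => hj (σ.injective (Fin.ext (h.trans hz.symm)))
  have hn : 0 < n := z.pos
  have hnRL : ¬ IsRLMax σ z := fun h => by
    have := h ⟨n - 1, by omega⟩ (Fin.lt_def.2 (by simp only; omega))
    rw [Fin.lt_def, hz] at this
    omega
  rw [labels, mem_admissible h0 h1]
  refine ⟨⟨fun j hj => ?_, fun j hj => ?_, ?_⟩, fun j hj => ?_, fun j hj => ?_⟩
  · rw [posLabel_eq_true]
    refine Or.inl fun k hk => ?_
    rw [Fin.lt_def] at hk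
    omega
  · rw [posLabel_eq_true]
    refine Or.inr fun k hk => ?_
    rw [Fin.lt_def] at hk
    omega
  · rw [posLabel_eq_false]
    refine ⟨fun h => ?_, hnRL⟩
    have := h ⟨0, hn⟩ (Fin.lt_def.2 h0)
    rw [Fin.lt_def, hz] at this
    omega
  · have : j = σ z := Fin.ext (by omega)
    rw [this, valLabel_eq_true]
    exact ⟨hnRL, Or.inr fun k hk => hmin k hk.ne⟩
  · obtain ⟨m, rfl⟩ := σ.surjective j
    rw [valLabel_eq_false]
    refine Or.inl fun k hk => ?_
    have h2 : (σ k : ℕ) ≠ σ m := fun h => hk.ne' (σ.injective (Fin.ext h))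
    have := (σ k).2
    rw [Fin.lt_def]
    omega

theorem card_sqFiber_le {z : Fin n} (h0 : 0 < (z : ℕ)) (h1 : (z : ℕ) + 1 < n) :
    (sqFiber z).card ≤ numAdmissible n := by
  rw [← card_admissible h0 h1]
  exact Finset.card_le_card_of_injOn labels
    (fun σ hσ => labels_mem_admissible h0 h1 (mem_sqFiber.1 hσ).2) (injOn_labels z)

/-- A crude bound that also covers the two end positions, where the letters counted by
`numAdmissible` are not all forced. -/
theorem card_sqFiber_le' (z : Fin n) : (sqFiber z).card ≤ 2 ^ n * 2 ^ n := by
  have := Finset.card_le_card_of_injOn labels (t := Finset.univ)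
    (fun σ _ => Finset.mem_univ _) (injOn_labels z)
  simpa using this

/-- Both words of labels of the permutation are balanced. -/
def HasBalancedLabels (δ : ℕ) (σ : Equiv.Perm (Fin n)) : Prop :=
  IsBalanced δ (posLabel σ) ∧ IsBalanced δ (valLabel σ)

theorem card_unbalanced_pairs_le {δ : ℕ} (s : Finset ((Fin n → Bool) × (Fin n → Bool)))
    (hs : ∀ w ∈ s, ¬ (IsBalanced δ w.1 ∧ IsBalanced δ w.2)) :
    s.card ≤ 2 * (2 ^ n * (unbalanced n δ).card) := by
  have h : s ⊆ unbalanced n δ ×ˢ Finset.univ ∪ Finset.univ ×ˢ unbalanced n δ := by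
    intro w hw
    have := hs w hw
    simp only [Finset.mem_union, Finset.mem_product, mem_unbalanced, Finset.mem_univ, and_true,
      true_and]
    tauto
  refine (Finset.card_le_card h).trans ((Finset.card_union_le _ _).trans ?_)
  rw [Finset.card_product, Finset.card_product]
  simp only [Finset.card_univ, Fintype.card_pi, Fintype.card_bool, Finset.prod_const,
    Fintype.card_fin]
  exact le_of_eq (by ring)

open Classical in
theorem card_sqFiber_unbalanced_le (δ : ℕ) (z : Fin n) :
    ((sqFiber z).filter fun σ => ¬ HasBalancedLabels δ σ).card
      ≤ 2 * (2 ^ n * (unbalanced n δ).card) := by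
  rw [← Finset.card_image_of_injOn ((injOn_labels z).mono (Finset.coe_subset.2
    (Finset.filter_subset (fun σ => ¬ HasBalancedLabels δ σ) _)))]
  refine card_unbalanced_pairs_le _ fun w hw => ?_
  obtain ⟨σ, hσ, rfl⟩ := Finset.mem_image.1 hw
  exact (Finset.mem_filter.1 hσ).2

/-- Every balanced admissible pair is the pair of labels of its own decoding, which is a square
permutation; the other pairs are counted by the last term. -/
theorem numAdmissible_le_card_sqFiber {δ : ℕ} {z : Fin n} (hz1 : 6 * δ + 6 ≤ (z : ℕ))
    (hz2 : (z : ℕ) + 6 * δ + 6 ≤ n) :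
    numAdmissible n ≤ (sqFiber z).card + 2 * (2 ^ n * (unbalanced n δ).card) := by
  classical
  have h0 : 0 < (z : ℕ) := by omega
  have h1 : (z : ℕ) + 1 < n := by omega
  rw [← card_admissible h0 h1, ← Finset.card_filter_add_card_filter_not
    (fun w => IsBalanced δ w.1 ∧ IsBalanced δ w.2)]
  refine add_le_add ?_ (card_unbalanced_pairs_le _ fun w hw => (Finset.mem_filter.1 hw).2)
  refine Finset.card_le_card_of_surjOn labels ?_
  rintro ⟨X, Y⟩ hw
  rw [Finset.mem_coe, Finset.mem_filter, mem_admissible h0 h1] at hw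
  obtain ⟨⟨⟨hX0, hXn, hXz⟩, hY0, hYn⟩, hX, hY⟩ := hw
  simp only at hX hY
  have e1 := hX.bound false (k := (z : ℕ) + 1) z.2
  have e2 := hX.bound true le_rfl
  have e3 := hY.bound true le_rfl
  obtain ⟨σ, hσ⟩ := exists_isDecoding (X := X) (Y := Y) (z := z) (by omega) (by omega)
  refine ⟨σ, ?_, ?_⟩
  · rw [Finset.mem_coe, mem_sqFiber]
    exact ⟨hσ.isRecord hX hY hz1 hz2, hσ.apply_min hXz hY0⟩
  · rw [labels, hσ.posLabel_eq hX hY hz1 hz2 hX0 hXn,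
      hσ.valLabel_eq hX hY hz1 hz2 hXz hX0 hXn hY0 hYn]

end Fibers

/-! ### The sides of the rectangle as two graphs -/

section Graphs

/-- The height of the two upper sides of the rectangle. -/
noncomputable def upHeight (z x : ℝ) : ℝ := min (x + z) (2 - z - x)

/-- The height of the two lower sides of the rectangle. -/
noncomputable def lowHeight (z x : ℝ) : ℝ := |x - z|

theorem abs_upHeight_sub_le (z x z' x' : ℝ) :
    |upHeight z x - upHeight z' x'| ≤ |z - z'| + |x - x'| := by
  refine (abs_min_sub_min_le_max _ _ _ _).trans (max_le ?_ ?_)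
  · rw [show x + z - (x' + z') = (z - z') + (x - x') by ring]
    exact abs_add_le _ _
  · rw [show 2 - z - x - (2 - z' - x') = -((z - z') + (x - x')) by ring, abs_neg]
    exact abs_add_le _ _

theorem abs_lowHeight_sub_le (z x z' x' : ℝ) :
    |lowHeight z x - lowHeight z' x'| ≤ |z - z'| + |x - x'| := by
  refine (abs_abs_sub_abs_le_abs_sub _ _).trans ?_
  rw [show x - z - (x' - z') = -(z - z') + (x - x') by ring]
  exact (abs_add_le _ _).trans (by rw [abs_neg])

/-- A function on the unit square, along the graph of `g`. -/
noncomputable def alongGraph (φ : unitInterval × unitInterval → ℝ) (g : ℝ → ℝ) (t : unitInterval) : ℝ :=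
  φ (t, projIcc 0 1 zero_le_one (g t))

theorem abs_sub_le_of_lipschitz {φ : unitInterval × unitInterval → ℝ} {K : NNReal}
    (hφ : LipschitzWith K φ) {t t' : unitInterval} {y y' : unitInterval} {r : ℝ}
    (h1 : |(t : ℝ) - t'| ≤ r) (h2 : |(y : ℝ) - y'| ≤ r) : |φ (t, y) - φ (t', y')| ≤ K * r := by
  have h := hφ.dist_le_mul (t, y) (t', y')
  rw [Real.dist_eq] at h
  refine h.trans (mul_le_mul_of_nonneg_left ?_ K.2)
  rw [Prod.dist_eq]
  exact max_le h1 h2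

theorem abs_alongGraph_sub_le {φ : unitInterval × unitInterval → ℝ} {K : NNReal}
    (hφ : LipschitzWith K φ) {g g' : ℝ → ℝ} {t t' : unitInterval} {r : ℝ}
    (h1 : |(t : ℝ) - t'| ≤ r) (h2 : |g t - g' t'| ≤ r) :
    |alongGraph φ g t - alongGraph φ g' t'| ≤ K * r :=
  abs_sub_le_of_lipschitz hφ h1 ((abs_projIcc_sub_projIcc zero_le_one).trans h2)

theorem continuous_alongGraph {φ : unitInterval × unitInterval → ℝ} (hφ : Continuous φ)
    {g : ℝ → ℝ} (hg : Continuous g) : Continuous (alongGraph φ g) :=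
  hφ.comp (continuous_id.prodMk (continuous_projIcc.comp (hg.comp continuous_subtype_val)))

theorem continuous_upHeight (z : ℝ) : Continuous (upHeight z) := by
  unfold upHeight
  fun_prop

theorem continuous_lowHeight (z : ℝ) : Continuous (lowHeight z) := by
  unfold lowHeight
  fun_prop

theorem integrable_of_continuous {α : Type*} [TopologicalSpace α] [CompactSpace α]
    [MeasurableSpace α] [OpensMeasurableSpace α] {μ : Measure α} [IsFiniteMeasure μ]
    {f : α → ℝ} (hf : Continuous f) : Integrable f μ :=
  (BoundedContinuousFunction.mkOfCompact ⟨f, hf⟩).integrable μ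

instance (D : Set unitInterval) (g : ℝ → ℝ) : IsFiniteMeasure (sideMeasure D g) := by
  unfold sideMeasure
  refine ⟨?_⟩
  rw [Measure.smul_apply, smul_eq_mul]
  exact ENNReal.mul_lt_top (by simp) (measure_lt_top _ _)

theorem integral_sideMeasure {φ : unitInterval × unitInterval → ℝ} (hφ : Continuous φ)
    (D : Set unitInterval) {g : ℝ → ℝ} (hg : Continuous g) :
    ∫ p, φ p ∂(sideMeasure D g) = 2⁻¹ * ∫ t in D, alongGraph φ g t := by
  have hm : Continuous fun t : unitInterval =>
      (t, (projIcc 0 1 zero_le_one (g t) : unitInterval)) :=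
    continuous_id.prodMk (continuous_projIcc.comp (hg.comp continuous_subtype_val))
  rw [sideMeasure, integral_smul_measure, integral_map hm.measurable.aemeasurable
    hφ.aestronglyMeasurable]
  simp [alongGraph]

theorem integral_glue (c : ℝ) {f : unitInterval → ℝ} (hf : Continuous f) :
    (∫ t in {t : unitInterval | (t : ℝ) ≤ c}, f t) + ∫ t in {t : unitInterval | c ≤ (t : ℝ)}, f t
      = ∫ t, f t := by
  have hs : MeasurableSet {t : unitInterval | (t : ℝ) ≤ c} :=
    measurableSet_le measurable_subtype_coe measurable_const
  rw [← integral_add_compl hs (integrable_of_continuous (μ := volume) hf), add_right_inj]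
  refine setIntegral_congr_set ?_
  have h0 : volume {t : unitInterval | (t : ℝ) = c} = 0 := by
    refine Set.Subsingleton.measure_zero (fun a ha b hb => ?_) _
    exact Subtype.ext ((show (a : ℝ) = c from ha).trans (show (b : ℝ) = c from hb).symm)
  have h1 : ∀ᵐ t : unitInterval, (t : ℝ) ≠ c := by
    rw [ae_iff]
    simpa using h0
  filter_upwards [h1] with t ht
  apply propext
  change c ≤ (t : ℝ) ↔ ¬ ((t : ℝ) ≤ c)
  rw [not_le]
  exact ⟨fun h => lt_of_le_of_ne h ht.symm, le_of_lt⟩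

/-- The first and third sides together are the graph of `lowHeight`, with its corner at `z`; the
second and fourth are the graph of `upHeight`, with its corner at `1 - z`. The shared abscissa is
negligible. -/
theorem integral_rectMeasure {φ : unitInterval × unitInterval → ℝ} (hφ : Continuous φ)
    (z : unitInterval) : ∫ p, φ p ∂(rectMeasure z) =
      2⁻¹ * ((∫ t, alongGraph φ (upHeight z) t) + ∫ t, alongGraph φ (lowHeight z) t) := by
  have hi : ∀ D g, Integrable φ (sideMeasure D g) := fun D g => integrable_of_continuous hφ
  have hm1 : MeasurableSet {t : unitInterval | (t : ℝ) ≤ z} :=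
    measurableSet_le measurable_subtype_coe measurable_const
  have hm2 : MeasurableSet {t : unitInterval | (t : ℝ) ≤ 1 - z} :=
    measurableSet_le measurable_subtype_coe measurable_const
  have hm3 : MeasurableSet {t : unitInterval | (z : ℝ) ≤ t} :=
    measurableSet_le measurable_const measurable_subtype_coe
  have hm4 : MeasurableSet {t : unitInterval | 1 - (z : ℝ) ≤ t} :=
    measurableSet_le measurable_const measurable_subtype_coe
  unfold rectMeasure side1 side2 side3 side4
  rw [integral_add_measure (((hi _ _).add_measure (hi _ _)).add_measure (hi _ _)) (hi _ _),
    integral_add_measure ((hi _ _).add_measure (hi _ _)) (hi _ _),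
    integral_add_measure (hi _ _) (hi _ _),
    integral_sideMeasure hφ _ (by fun_prop), integral_sideMeasure hφ _ (by fun_prop),
    integral_sideMeasure hφ _ (by fun_prop), integral_sideMeasure hφ _ (by fun_prop),
    ← integral_glue z (continuous_alongGraph hφ (continuous_lowHeight z)),
    ← integral_glue (1 - z) (continuous_alongGraph hφ (continuous_upHeight z)),
    setIntegral_congr_fun (g := alongGraph φ (lowHeight z)) hm1,
    setIntegral_congr_fun (g := alongGraph φ (upHeight z)) hm2,
    setIntegral_congr_fun (g := alongGraph φ (lowHeight z)) hm3,
    setIntegral_congr_fun (g := alongGraph φ (upHeight z)) hm4]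
  · ring
  all_goals
    intro t ht
    simp only [mem_ofPred_eq] at ht
    simp only [alongGraph, upHeight, lowHeight]
  · rw [min_eq_right (by linarith)]
  · rw [abs_of_nonneg (by linarith)]
  · rw [min_eq_left (by linarith)]
  · rw [abs_of_nonpos (by linarith), neg_sub]

theorem abs_integral_rectMeasure_sub_le {φ : unitInterval × unitInterval → ℝ} {K : NNReal}
    (hφ : LipschitzWith K φ) (z z' : unitInterval) :
    |∫ p, φ p ∂(rectMeasure z) - ∫ p, φ p ∂(rectMeasure z')| ≤ K * |(z : ℝ) - z'| := by
  have key : ∀ g g' : ℝ → ℝ, Continuous g → Continuous g' →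
      (∀ x : ℝ, |g x - g' x| ≤ |(z : ℝ) - z'|) →
      |(∫ t, alongGraph φ g t) - ∫ t, alongGraph φ g' t| ≤ K * |(z : ℝ) - z'| := by
    intro g g' hg hg' hgg
    rw [← integral_sub (integrable_of_continuous (continuous_alongGraph hφ.continuous hg))
      (integrable_of_continuous (continuous_alongGraph hφ.continuous hg'))]
    have := norm_integral_le_of_norm_le_const (μ := (volume : Measure unitInterval))
      (f := fun t => alongGraph φ g t - alongGraph φ g' t) (C := K * |(z : ℝ) - z'|)
      (Filter.Eventually.of_forall fun t =>
        abs_alongGraph_sub_le hφ (by rw [sub_self, abs_zero]; exact abs_nonneg _) (hgg t))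
    simpa using this
  have h1 := key (upHeight z) (upHeight z') (continuous_upHeight z) (continuous_upHeight z')
    fun x => (abs_upHeight_sub_le z x z' x).trans (by simp)
  have h2 := key (lowHeight z) (lowHeight z') (continuous_lowHeight z) (continuous_lowHeight z')
    fun x => (abs_lowHeight_sub_le z x z' x).trans (by simp)
  rw [integral_rectMeasure hφ.continuous, integral_rectMeasure hφ.continuous]
  rw [abs_le] at h1 h2 ⊢
  constructor <;> linarith

end Graphs

/-! ### The permuton of a square permutation is close to a rectangle -/

section Approximation

theorem sum_restrict_cell (n : ℕ) [NeZero n] :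
    ∑ i : Fin n, (volume : Measure unitInterval).restrict (cell n i) = volume := by
  have : IsFiniteMeasure (∑ i : Fin n, (volume : Measure unitInterval).restrict (cell n i)) := by
    refine ⟨?_⟩
    rw [Measure.finsetSum_apply]
    exact ENNReal.sum_lt_top.2 fun i _ => measure_lt_top _ _
  refine Measure.ext_of_Iic _ _ fun b => ?_
  have hb : Iic b = Icc (0 : unitInterval) b := by
    ext t
    simp
  rw [Measure.finsetSum_apply, hb]
  simp only [Measure.restrict_apply measurableSet_Icc]
  rw [sum_volume_inter_cell n (unitInterval.nonneg' (t := b)),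
    volume_of_mem_iff (l := (0 : ℝ)) (u := b) le_rfl b.2.2]
  · simp
  · intro t
    simp only [mem_Icc, ← Subtype.coe_le_coe]
    rfl

theorem integral_eq_sum_cell (n : ℕ) [NeZero n] {f : unitInterval → ℝ} (hf : Continuous f) :
    ∫ t, f t = ∑ i : Fin n, ∫ t in cell n i, f t := by
  rw [← integral_finsetSum_measure fun i _ => integrable_of_continuous hf, sum_restrict_cell]

theorem volume_real_cell {n : ℕ} (k : Fin n) : volume.real (cell n k) = (n : ℝ)⁻¹ := by
  rw [Measure.real, volume_cell, ENNReal.toReal_inv, ENNReal.toReal_natCast]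

theorem integral_permMeasure {n : ℕ} (σ : Equiv.Perm (Fin n))
    {φ : unitInterval × unitInterval → ℝ} (hφ : Continuous φ) :
    ∫ p, φ p ∂(permMeasure σ)
      = ∑ i, (n : ℝ) * ∫ p in cell n i ×ˢ cell n (σ i), φ p := by
  rw [permMeasure, integral_smul_measure,
    integral_finsetSum_measure fun i _ => integrable_of_continuous hφ, Finset.smul_sum]
  simp

/-- The mass of one small square is pushed vertically onto the graph of `g`. Since the cell `j` has
length `1 / n`, the integral along the graph is itself `n` times an integral over the square, so the
integrands can be compared pointwise. -/
theorem abs_integral_cell_prod_sub_le {n : ℕ} (i j : Fin n)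
    {φ : unitInterval × unitInterval → ℝ} {K : NNReal} (hφ : LipschitzWith K φ) {g : ℝ → ℝ}
    (hg : Continuous g) {r : ℝ} (hr : 0 ≤ r)
    (h : ∀ t ∈ cell n i, ∀ s ∈ cell n j, |(s : ℝ) - g t| ≤ r) :
    |n * (∫ p in cell n i ×ˢ cell n j, φ p) - ∫ t in cell n i, alongGraph φ g t|
      ≤ K * r * (n : ℝ)⁻¹ := by
  have hn : (0 : ℝ) < n := by exact_mod_cast i.pos
  have e1 : ∫ t in cell n i, alongGraph φ g t
      = n * ∫ p in cell n i ×ˢ cell n j, alongGraph φ g p.1 := by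
    have := setIntegral_prod_mul (μ := (volume : Measure unitInterval))
      (ν := (volume : Measure unitInterval)) (alongGraph φ g) (fun _ => (1 : ℝ))
      (cell n i) (cell n j)
    simp only [mul_one] at this
    rw [Measure.volume_eq_prod, this]
    simp only [integral_const, smul_eq_mul, mul_one, measureReal_restrict_apply_univ,
      volume_real_cell]
    field_simp
  have hcont : Continuous fun p : unitInterval × unitInterval => alongGraph φ g p.1 :=
    (continuous_alongGraph hφ.continuous hg).comp continuous_fst
  rw [e1, ← mul_sub, ← integral_sub (integrable_of_continuous hφ.continuous)
    (integrable_of_continuous hcont),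
    abs_mul, abs_of_pos hn]
  have h2 := norm_setIntegral_le_of_norm_le_const
    (μ := (volume : Measure (unitInterval × unitInterval))) (s := cell n i ×ˢ cell n j)
    (f := fun p => φ p - alongGraph φ g p.1) (C := K * r) (measure_lt_top _ _)
    (fun p hp => by
      refine abs_sub_le_of_lipschitz hφ (by rwa [sub_self, abs_zero]) ?_
      have h3 := abs_projIcc_sub_projIcc (a := (0 : ℝ)) (b := 1) (c := p.2) (d := g p.1)
        zero_le_one
      rw [projIcc_val] at h3
      exact h3.trans (h p.1 hp.1 p.2 hp.2))
  have h3 : volume.real (cell n i ×ˢ cell n j) = (n : ℝ)⁻¹ * (n : ℝ)⁻¹ := by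
    rw [Measure.volume_eq_prod, measureReal_prod_prod, volume_real_cell, volume_real_cell]
  rw [h3, Real.norm_eq_abs] at h2
  calc (n : ℝ) * _ ≤ n * (K * r * ((n : ℝ)⁻¹ * (n : ℝ)⁻¹)) :=
        mul_le_mul_of_nonneg_left h2 hn.le
    _ = K * r * (n : ℝ)⁻¹ := by field_simp

theorem abs_integral_cell_sub_le {n : ℕ} (i : Fin n) {f : unitInterval → ℝ} (hf : Continuous f)
    {c r : ℝ} (h : ∀ t ∈ cell n i, |f t - c| ≤ r) :
    |(∫ t in cell n i, f t) - c * (n : ℝ)⁻¹| ≤ r * (n : ℝ)⁻¹ := by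
  have h2 := norm_setIntegral_le_of_norm_le_const
    (μ := (volume : Measure unitInterval)) (s := cell n i)
    (f := fun t => f t - c) (C := r) (measure_lt_top _ _) h
  rw [integral_sub (integrable_of_continuous hf) (integrable_const _), volume_real_cell] at h2
  simp only [integral_const, smul_eq_mul, measureReal_restrict_apply_univ,
    volume_real_cell, Real.norm_eq_abs] at h2
  rwa [mul_comm (n : ℝ)⁻¹ c] at h2

/-- Summation by parts: slowly varying weights against increments with small partial sums. -/
theorem abs_sum_increment_mul_le {S g : ℕ → ℝ} {δ M r : ℝ} {n : ℕ} (h0 : S 0 = 0)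
    (hS : ∀ k ≤ n, |S k| ≤ δ) (hM : |g n| ≤ M) (hg : ∀ k < n, |g (k + 1) - g k| ≤ r) :
    |∑ i ∈ Finset.range n, (S (i + 1) - S i) * g i| ≤ δ * (M + n * r) := by
  have hδ : 0 ≤ δ := (abs_nonneg _).trans (hS 0 (Nat.zero_le _))
  have key : ∀ m ≤ n,
      |∑ i ∈ Finset.range m, (S (i + 1) - S i) * g i - S m * g m| ≤ δ * (m * r) := by
    intro m
    induction m with
    | zero => simp [h0]
    | succ m ih =>
      intro hm
      have h1 := ih (by omega)
      have h2 : |S (m + 1) * (g (m + 1) - g m)| ≤ δ * r := by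
        rw [abs_mul]
        exact mul_le_mul (hS _ hm) (hg m hm) (abs_nonneg _) hδ
      rw [Finset.sum_range_succ]
      rw [abs_le] at h1 h2 ⊢
      push_cast
      constructor <;> nlinarith
  have h1 := key n le_rfl
  have h2 : |S n * g n| ≤ δ * M := by
    rw [abs_mul]
    exact mul_le_mul (hS n le_rfl) hM (abs_nonneg _) hδ
  rw [abs_le] at h1 h2 ⊢
  constructor <;> nlinarith

variable {n : ℕ} {X Y : Fin n → Bool} {z : Fin n} {σ : Equiv.Perm (Fin n)}

/-- The constant `11` is generous: it absorbs the error `3 * δ` and the rounding of both coordinates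
to cells. -/
theorem IsDecoding.abs_sub_lowHeight_le (h : IsDecoding X Y z σ) {δ : ℕ} (hX : IsBalanced δ X)
    (hY : IsBalanced δ Y) {i : Fin n} (hi : X i = false) {t s : unitInterval}
    (ht : t ∈ cell n i) (hs : s ∈ cell n (σ i)) :
    |(s : ℝ) - lowHeight ((z : ℝ) / n) t| ≤ 11 * (δ + 1) / n := by
  have hn : (0 : ℝ) < n := by exact_mod_cast i.pos
  obtain ⟨ht1, ht2⟩ := ht
  obtain ⟨hs1, hs2⟩ := hs
  rw [div_le_iff₀ hn] at ht1 hs1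
  rw [le_div_iff₀ hn] at ht2 hs2
  have hδ : (0 : ℝ) ≤ δ := Nat.cast_nonneg δ
  have e : (s : ℝ) - lowHeight ((z : ℝ) / n) t
      = ((s : ℝ) * n - |(t : ℝ) * n - z|) / n := by
    rw [lowHeight, sub_div, mul_div_cancel_right₀ _ hn.ne', show |(t : ℝ) * n - z| / n
      = |((t : ℝ) * n - z) / n| by rw [abs_div, abs_of_pos hn], sub_div,
      mul_div_cancel_right₀ _ hn.ne']
  rw [e, abs_div, abs_of_pos hn]
  refine div_le_div_of_nonneg_right ?_ hn.le
  rcases le_or_gt i z with h' | h'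
  · have hb := h.lowLeft_bound hX hY hi h'
    have h1 : ((σ i : ℕ) : ℝ) + i ≤ z + 3 * δ := by exact_mod_cast hb.1
    have h2 : (z : ℝ) ≤ (σ i : ℕ) + i + 3 * δ := by exact_mod_cast hb.2
    have h3 : (i : ℝ) ≤ z := by exact_mod_cast h'
    rcases abs_cases ((t : ℝ) * n - z) with ⟨h4, h5⟩ | ⟨h4, h5⟩ <;> rw [h4, abs_le] <;>
      constructor <;> linarith
  · have hb := h.lowRight_bound hX hY hi h'
    have h1 : ((σ i : ℕ) : ℝ) + z + 1 ≤ i + 3 * δ := by exact_mod_cast hb.1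
    have h2 : (i : ℝ) ≤ (σ i : ℕ) + z + 1 + 3 * δ := by exact_mod_cast hb.2
    have h3 : (z : ℝ) ≤ i := by exact_mod_cast h'.le
    rcases abs_cases ((t : ℝ) * n - z) with ⟨h4, h5⟩ | ⟨h4, h5⟩ <;> rw [h4, abs_le] <;>
      constructor <;> linarith

theorem IsDecoding.abs_sub_upHeight_le (h : IsDecoding X Y z σ) {δ : ℕ} (hX : IsBalanced δ X)
    (hY : IsBalanced δ Y) {i : Fin n} (hi : X i = true) {t s : unitInterval}
    (ht : t ∈ cell n i) (hs : s ∈ cell n (σ i)) :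
    |(s : ℝ) - upHeight ((z : ℝ) / n) t| ≤ 11 * (δ + 1) / n := by
  have hn : (0 : ℝ) < n := by exact_mod_cast i.pos
  obtain ⟨ht1, ht2⟩ := ht
  obtain ⟨hs1, hs2⟩ := hs
  rw [div_le_iff₀ hn] at ht1 hs1
  rw [le_div_iff₀ hn] at ht2 hs2
  have hδ : (0 : ℝ) ≤ δ := Nat.cast_nonneg δ
  -- The side given by the labels may differ from the branch attaining the minimum. This happens
  -- only near the top corner, where the bound on the value keeps both branches close.
  have hv : ((σ i : ℕ) : ℝ) ≤ n := by exact_mod_cast (σ i).2.le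
  have e : (s : ℝ) - upHeight ((z : ℝ) / n) t
      = ((s : ℝ) * n - min ((t : ℝ) * n + z) (2 * n - z - (t : ℝ) * n)) / n := by
    rw [upHeight, sub_div, mul_div_cancel_right₀ _ hn.ne', ← min_div_div_right hn.le]
    congr 2 <;> field_simp
  rw [e, abs_div, abs_of_pos hn]
  refine div_le_div_of_nonneg_right ?_ hn.le
  rcases lt_or_ge (cnt X true i + cnt X false ((z : ℕ) + 1)) (cnt Y true n) with h' | h'
  · have hb := h.upLeft_bound hX hY hi h'
    have h1 : ((σ i : ℕ) : ℝ) ≤ i + z + 1 + 3 * δ := by exact_mod_cast hb.1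
    have h2 : (i : ℝ) + z + 1 ≤ (σ i : ℕ) + 3 * δ := by exact_mod_cast hb.2
    rcases min_cases ((t : ℝ) * n + z) (2 * n - z - t * n) with ⟨h4, h5⟩ | ⟨h4, h5⟩ <;>
      rw [h4, abs_le] <;> constructor <;> linarith
  · have hb := h.upRight_bound hX hY hi h'
    have h1 : ((σ i : ℕ) : ℝ) + i + z + 3 ≤ 2 * n + 3 * δ := by exact_mod_cast hb.1
    have h2 : 2 * (n : ℝ) ≤ (σ i : ℕ) + i + z + 3 + 3 * δ := by exact_mod_cast hb.2
    rcases min_cases ((t : ℝ) * n + z) (2 * n - z - t * n) with ⟨h4, h5⟩ | ⟨h4, h5⟩ <;>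
      rw [h4, abs_le] <;> constructor <;> linarith

theorem IsBalanced.abs_excess_le {δ : ℕ} (hX : IsBalanced δ X) {k : ℕ} (hk : k ≤ n) :
    |((excess X k : ℤ) : ℝ)| ≤ δ := by
  have h := hX k hk
  have h1 : |excess X k| ≤ δ := by
    rw [abs_le]
    unfold excess
    omega
  exact_mod_cast h1

/-- The position of the minimum, rescaled to the unit interval. -/
noncomputable def scaledPos (z : Fin n) : unitInterval :=
  ⟨(z : ℝ) / n, by positivity, div_le_one_of_le₀ (by exact_mod_cast z.2.le) (Nat.cast_nonneg n)⟩

/-- Along a balanced word, either letter sees half of the length. -/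
theorem IsBalanced.abs_sum_integral_sub_le {δ : ℕ} (hX : IsBalanced δ X) [NeZero n]
    {f g : unitInterval → ℝ} {K : NNReal} {M : ℝ} (hf : LipschitzWith K f)
    (hg : LipschitzWith K g) (hfM : ∀ t, |f t| ≤ M) (hgM : ∀ t, |g t| ≤ M) :
    |(∑ i, ∫ t in cell n i, (if X i then f t else g t)) - 2⁻¹ * ((∫ t, f t) + ∫ t, g t)|
      ≤ (K + M) * (δ + 1) / n := by
  have hn : (0 : ℝ) < n := by exact_mod_cast Nat.pos_of_ne_zero (NeZero.ne n)
  have hM : 0 ≤ M := (abs_nonneg _).trans (hfM 0)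
  let G : ℕ → ℝ := fun k => f (projIcc 0 1 zero_le_one ((k : ℝ) / n))
    - g (projIcc 0 1 zero_le_one ((k : ℝ) / n))
  have hfg : ∀ t s : unitInterval, |(f t - g t) - (f s - g s)| ≤ 2 * K * |(t : ℝ) - s| := by
    intro t s
    have h1 := hf.dist_le_mul t s
    have h2 := hg.dist_le_mul t s
    rw [Real.dist_eq, Subtype.dist_eq, Real.dist_eq, abs_le] at h1 h2
    rw [abs_le]
    constructor <;> linarith
  have hG1 : |G n| ≤ 2 * M := by
    have h1 := abs_le.1 (hfM (projIcc 0 1 zero_le_one ((n : ℝ) / n)))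
    have h2 := abs_le.1 (hgM (projIcc 0 1 zero_le_one ((n : ℝ) / n)))
    rw [abs_le]
    constructor <;> simp only [G] <;> linarith
  have hG2 : ∀ k < n, |G (k + 1) - G k| ≤ 2 * K * (n : ℝ)⁻¹ := by
    intro k _
    refine (hfg _ _).trans (mul_le_mul_of_nonneg_left ?_ (by positivity))
    refine (abs_projIcc_sub_projIcc zero_le_one).trans (le_of_eq ?_)
    rw [← sub_div]
    push_cast
    rw [add_sub_cancel_left, one_div, abs_of_pos (by positivity)]
  -- The signs of the letters are the increments of the excess, which balance keeps below `δ`, while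
  -- `G` changes by at most `2K / n` per step.
  have hsum := abs_sum_increment_mul_le (S := fun k => ((excess X k : ℤ) : ℝ)) (g := G) (n := n)
    (by simp [excess, cnt_zero]) (fun k hk => hX.abs_excess_le hk) hG1 hG2
  have hcell : ∀ i : Fin n,
      |(∫ t in cell n i, (f t - g t)) - G i * (n : ℝ)⁻¹| ≤ 2 * K * (n : ℝ)⁻¹ * (n : ℝ)⁻¹ := by
    intro i
    refine abs_integral_cell_sub_le i (hf.continuous.sub hg.continuous) fun t ht => ?_
    refine (hfg _ _).trans (mul_le_mul_of_nonneg_left ?_ (by positivity))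
    obtain ⟨ht1, ht2⟩ := ht
    rw [projIcc_of_mem zero_le_one ⟨by positivity, ht1.trans t.2.2⟩]
    rw [add_div, one_div] at ht2
    rw [abs_of_nonneg (by simpa using ht1)]
    simp only
    linarith
  -- The choice between `f` and `g` is their mean plus half of a signed difference; only the signed
  -- part is left to estimate.
  have hint : ∀ i : Fin n, (∫ t in cell n i, (if X i then f t else g t))
      = 2⁻¹ * ((∫ t in cell n i, f t) + ∫ t in cell n i, g t)
        + 2⁻¹ * (if X i then 1 else -1) * ∫ t in cell n i, (f t - g t) := by
    intro i
    rw [integral_sub (integrable_of_continuous hf.continuous)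
      (integrable_of_continuous hg.continuous)]
    cases X i <;> simp <;> ring
  rw [integral_eq_sum_cell n hf.continuous, integral_eq_sum_cell n hg.continuous,
    Finset.sum_congr rfl fun i _ => hint i, Finset.sum_add_distrib, ← Finset.mul_sum,
    Finset.sum_add_distrib, add_sub_cancel_left]
  have hsgn : ∀ i : Fin n, (if X i then (1 : ℝ) else -1)
      = ((excess X ((i : ℕ) + 1) : ℤ) : ℝ) - ((excess X (i : ℕ) : ℤ) : ℝ) := by
    intro i
    rw [excess_succ]
    push_cast
    split_ifs <;> ring
  have h1 : |(∑ i : Fin n, 2⁻¹ * (if X i then (1 : ℝ) else -1) * ∫ t in cell n i, (f t - g t))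
      - ∑ i : Fin n, 2⁻¹ * (if X i then (1 : ℝ) else -1) * (G i * (n : ℝ)⁻¹)|
      ≤ n * (K * (n : ℝ)⁻¹ * (n : ℝ)⁻¹) := by
    rw [← Finset.sum_sub_distrib]
    refine (Finset.abs_sum_le_sum_abs _ _).trans ?_
    have : ∀ i ∈ (Finset.univ : Finset (Fin n)),
        |2⁻¹ * (if X i then (1 : ℝ) else -1) * (∫ t in cell n i, (f t - g t))
          - 2⁻¹ * (if X i then (1 : ℝ) else -1) * (G i * (n : ℝ)⁻¹)|
        ≤ K * (n : ℝ)⁻¹ * (n : ℝ)⁻¹ := by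
      intro i _
      rw [← mul_sub, abs_mul]
      have h2 : |2⁻¹ * (if X i then (1 : ℝ) else -1)| = 2⁻¹ := by
        split_ifs <;> norm_num
      rw [h2]
      have := hcell i
      linarith
    refine (Finset.sum_le_sum this).trans ?_
    simp
  have h2 : |∑ i : Fin n, 2⁻¹ * (if X i then (1 : ℝ) else -1) * (G i * (n : ℝ)⁻¹)|
      ≤ 2⁻¹ * (n : ℝ)⁻¹ * (δ * (2 * M + n * (2 * K * (n : ℝ)⁻¹))) := by
    have e : ∑ i : Fin n, 2⁻¹ * (if X i then (1 : ℝ) else -1) * (G i * (n : ℝ)⁻¹)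
        = 2⁻¹ * (n : ℝ)⁻¹ * ∑ i ∈ Finset.range n,
          (((excess X (i + 1) : ℤ) : ℝ) - ((excess X i : ℤ) : ℝ)) * G i := by
      rw [← Fin.sum_univ_eq_sum_range
        (fun i => (((excess X (i + 1) : ℤ) : ℝ) - ((excess X i : ℤ) : ℝ)) * G i), Finset.mul_sum]
      refine Finset.sum_congr rfl fun i _ => ?_
      rw [hsgn i]
      ring
    rw [e, abs_mul, abs_of_pos (by positivity)]
    exact mul_le_mul_of_nonneg_left hsum (by positivity)
  have e1 : (n : ℝ) * (K * (n : ℝ)⁻¹ * (n : ℝ)⁻¹) = K / n := by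
    field_simp
  have e2 : 2⁻¹ * (n : ℝ)⁻¹ * (δ * (2 * M + n * (2 * K * (n : ℝ)⁻¹))) = (K + M) * δ / n := by
    field_simp
    ring
  have e3 : (K + M) * (δ + 1) / n = (K + M) * δ / n + K / n + M / (n : ℝ) := by ring
  have e4 : 0 ≤ M / (n : ℝ) := by positivity
  rw [e1] at h1
  rw [e2] at h2
  rw [e3]
  rw [abs_le] at h1 h2 ⊢
  constructor <;> linarith

theorem lipschitzWith_alongGraph {φ : unitInterval × unitInterval → ℝ} {K : NNReal}
    (hφ : LipschitzWith K φ) {g : ℝ → ℝ} (hg : ∀ x y, |g x - g y| ≤ |x - y|) :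
    LipschitzWith K (alongGraph φ g) := by
  refine LipschitzWith.of_dist_le_mul fun t s => ?_
  rw [Real.dist_eq, Subtype.dist_eq, Real.dist_eq]
  exact abs_alongGraph_sub_le hφ le_rfl (hg _ _)

/-- Moving the squares onto the graph chosen by each label costs `11 * K`, and replacing the labels
by equal halves costs `K + M`, both in units of `(δ + 1) / n`. -/
theorem abs_integral_permMeasure_sub_le [NeZero n] {δ : ℕ} (hσ : ∀ i, IsRecord σ i)
    (hz : (σ z : ℕ) = 0) (hb : HasBalancedLabels δ σ) {φ : unitInterval × unitInterval → ℝ}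
    {K : NNReal} {M : ℝ} (hφ : LipschitzWith K φ) (hM : ∀ p, |φ p| ≤ M) :
    |∫ p, φ p ∂(permMeasure σ) - ∫ p, φ p ∂(rectMeasure (scaledPos z))|
      ≤ (12 * K + M) * ((δ + 1) / n) := by
  have hn : (0 : ℝ) < n := by exact_mod_cast Nat.pos_of_ne_zero (NeZero.ne n)
  have hd := isDecoding_of_isRecord hσ hz
  have h1 := hb.1.abs_sum_integral_sub_le
    (lipschitzWith_alongGraph hφ (g := upHeight ((z : ℝ) / n)) fun x y =>
      (abs_upHeight_sub_le _ x _ y).trans (by simp))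
    (lipschitzWith_alongGraph hφ (g := lowHeight ((z : ℝ) / n)) fun x y =>
      (abs_lowHeight_sub_le _ x _ y).trans (by simp))
    (M := M) (fun t => hM _) (fun t => hM _)
  have h2 : |∫ p, φ p ∂(permMeasure σ) - ∑ i, ∫ t in cell n i, (if posLabel σ i then
      alongGraph φ (upHeight ((z : ℝ) / n)) t else alongGraph φ (lowHeight ((z : ℝ) / n)) t)|
      ≤ ∑ _i : Fin n, K * (11 * (δ + 1) / n) * (n : ℝ)⁻¹ := by
    rw [integral_permMeasure σ hφ.continuous, ← Finset.sum_sub_distrib]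
    refine (Finset.abs_sum_le_sum_abs _ _).trans (Finset.sum_le_sum fun i _ => ?_)
    rcases hi : posLabel σ i with _ | _
    · simp only [Bool.false_eq_true, if_false]
      exact abs_integral_cell_prod_sub_le i (σ i) hφ (continuous_lowHeight _) (by positivity)
        fun t ht s hs => hd.abs_sub_lowHeight_le hb.1 hb.2 hi ht hs
    · simp only [if_true]
      exact abs_integral_cell_prod_sub_le i (σ i) hφ (continuous_upHeight _) (by positivity)
        fun t ht s hs => hd.abs_sub_upHeight_le hb.1 hb.2 hi ht hs
  have h3 := integral_rectMeasure hφ.continuous (scaledPos z)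
  simp only [scaledPos] at h3
  rw [← h3] at h1
  have e : ∑ _i : Fin n, K * (11 * (δ + 1) / n) * (n : ℝ)⁻¹ = 11 * K * ((δ + 1) / n) := by
    rw [Finset.sum_const, Finset.card_univ, Fintype.card_fin, nsmul_eq_mul]
    field_simp
  rw [e] at h2
  have e2 : (K + M) * (δ + 1) / (n : ℝ) = (K + M) * ((δ + 1) / n) := by ring
  rw [e2] at h1
  refine (abs_sub_le _ _ _).trans ((add_le_add h2 h1).trans (le_of_eq ?_))
  ring

end Approximation

/-! ### Convergence in the space of permutons -/

section Convergence

/-- Lipschitz test functions suffice for weak convergence along a countably generated filter. The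
bound `M` comes from the bounded oscillation of `φ` and its value at `0`. -/
theorem tendsto_permuton_of_lipschitz {γ : Type*} {F : Filter γ} [F.IsCountablyGenerated]
    {q : γ → Permuton} {p : Permuton}
    (h : ∀ (φ : unitInterval × unitInterval → ℝ) (K : NNReal) (M : ℝ), LipschitzWith K φ →
      (∀ x, |φ x| ≤ M) →
      Tendsto (fun g => ∫ x, φ x ∂((q g).1 : Measure (unitInterval × unitInterval))) F
        (𝓝 (∫ x, φ x ∂(p.1 : Measure (unitInterval × unitInterval))))) :
    Tendsto q F (𝓝 p) := by
  have hind : IsInducing fun p : Permuton => p.1 := ⟨rfl⟩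
  rw [hind.tendsto_nhds_iff, tendsto_iff_forall_lipschitz_integral_tendsto]
  rintro φ ⟨C, hC⟩ ⟨K, hK⟩
  refine h φ K (C + |φ 0|) hK fun x => ?_
  have h1 := hC x 0
  rw [Real.dist_eq] at h1
  have h2 := abs_add_le (φ x - φ 0) (φ 0)
  rw [sub_add_cancel] at h2
  linarith

theorem continuous_rectPermuton : Continuous rectPermuton := by
  rw [continuous_iff_continuousAt]
  intro z
  refine tendsto_permuton_of_lipschitz fun φ K M hφ _ => ?_
  rw [tendsto_iff_dist_tendsto_zero]
  have h0 : Tendsto (fun z' : unitInterval => (K : ℝ) * |(z' : ℝ) - z|) (𝓝 z) (𝓝 0) := by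
    have : Continuous fun z' : unitInterval => (K : ℝ) * |(z' : ℝ) - z| := by fun_prop
    simpa using this.tendsto z
  exact squeeze_zero (fun _ => dist_nonneg)
    (fun z' => abs_integral_rectMeasure_sub_le hφ z' z) h0

/-- A square permutation with balanced labels, and the data that measure its distance from
a rectangle. -/
structure BalancedSquare where
  /-- The size. -/
  size : ℕ+
  /-- The permutation. -/
  perm : Equiv.Perm (Fin size)
  /-- The position of the minimum. -/
  pos : Fin size
  /-- The deviation of the labels. -/
  dev : ℕ
  isRecord : ∀ i, IsRecord perm i
  apply_pos : (perm pos : ℕ) = 0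
  balanced : HasBalancedLabels dev perm

/-- The relative deviation. -/
noncomputable def BalancedSquare.err (s : BalancedSquare) : ℝ := ((s.dev : ℝ) + 1) / (s.size : ℕ)

/-- With all sizes gathered in one type, a small relative deviation and an anchor near `z` become a
filter. It is a pullback of a neighbourhood filter, hence countably generated. -/
theorem tendsto_permPermuton (z : unitInterval) :
    Tendsto (fun s : BalancedSquare => permPermuton s.perm)
      (comap (fun s => (s.err, scaledPos s.pos)) (𝓝 (0, z))) (𝓝 (rectPermuton z)) := by
  refine tendsto_permuton_of_lipschitz fun φ K M hφ hM => ?_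
  rw [tendsto_iff_dist_tendsto_zero]
  have h0 : Tendsto (fun p : ℝ × unitInterval => (12 * K + M) * p.1 + K * |(p.2 : ℝ) - z|)
      (𝓝 (0, z)) (𝓝 0) := by
    have : Continuous fun p : ℝ × unitInterval =>
        (12 * K + M) * p.1 + K * |(p.2 : ℝ) - z| := by fun_prop
    simpa using this.tendsto (0, z)
  refine squeeze_zero (fun _ => dist_nonneg) (fun s => ?_) (h0.comp tendsto_comap)
  refine (dist_triangle _ (∫ p, φ p ∂(rectMeasure (scaledPos s.pos))) _).trans ?_
  exact add_le_add (abs_integral_permMeasure_sub_le s.isRecord s.apply_pos s.balanced hφ hM)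
    (abs_integral_rectMeasure_sub_le hφ _ _)

/-- Compactness of the parameter interval replaces uniform continuity of `f`: along an ultrafilter
the rescaled anchors converge to some `z`, and both terms tend to the value of `f` at `rectPermuton
z`. -/
theorem tendsto_sub_rectPermuton {f : Permuton → ℝ} (hf : Continuous f) :
    Tendsto (fun s : BalancedSquare =>
      f (permPermuton s.perm) - f (rectPermuton (scaledPos s.pos)))
      (comap BalancedSquare.err (𝓝 0)) (𝓝 0) := by
  rw [tendsto_iff_ultrafilter]
  intro U hU
  obtain ⟨z, hz⟩ : ∃ z, Tendsto (fun s : BalancedSquare => scaledPos s.pos) U (𝓝 z) := by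
    obtain ⟨z, -, hz⟩ := isCompact_univ.ultrafilter_le_nhds
      (U.map fun s : BalancedSquare => scaledPos s.pos) (by simp)
    exact ⟨z, hz⟩
  have h1 : (U : Filter BalancedSquare)
      ≤ comap (fun s => (s.err, scaledPos s.pos)) (𝓝 (0, z)) := by
    rw [← tendsto_iff_comap]
    exact (tendsto_iff_comap.2 hU).prodMk_nhds hz
  have h2 := (hf.tendsto _).comp ((tendsto_permPermuton z).mono_left h1)
  have h3 := (hf.tendsto _).comp ((continuous_rectPermuton.tendsto z).comp hz)
  simpa using h2.sub h3

theorem exists_err_bound {f : Permuton → ℝ} (hf : Continuous f) {η : ℝ} (hη : 0 < η) :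
    ∃ ε > 0, ∀ s : BalancedSquare, s.err < ε →
      |f (permPermuton s.perm) - f (rectPermuton (scaledPos s.pos))| ≤ η := by
  have h := (tendsto_sub_rectPermuton hf).eventually (Metric.ball_mem_nhds 0 hη)
  rw [eventually_comap, Metric.eventually_nhds_iff] at h
  obtain ⟨ε, hε, h⟩ := h
  refine ⟨ε, hε, fun s hs => ?_⟩
  have hpos : 0 ≤ s.err := by
    unfold BalancedSquare.err
    positivity
  have := h (y := s.err) (by rwa [Real.dist_eq, sub_zero, abs_of_nonneg hpos]) s rfl
  rw [Real.dist_eq, sub_zero] at this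
  exact this.le

end Convergence

/-! ### Averages over square permutations -/

section Averages

open Classical in
/-- The square permutations. -/
noncomputable def sqFinset (n : ℕ) : Finset (Equiv.Perm (Fin n)) :=
  Finset.univ.filter fun σ => ∀ i, IsRecord σ i

theorem sum_sqFinset (n : ℕ) [NeZero n] (f : Equiv.Perm (Fin n) → ℝ) :
    ∑ σ ∈ sqFinset n, f σ = ∑ z : Fin n, ∑ σ ∈ sqFiber z, f σ := by
  classical
  rw [← Finset.sum_fiberwise (sqFinset n) (fun σ => σ.symm 0) f]
  refine Finset.sum_congr rfl fun z _ => Finset.sum_congr ?_ fun _ _ => rfl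
  ext σ
  rw [mem_sqFiber, Finset.mem_filter, sqFinset, Finset.mem_filter, Equiv.symm_apply_eq,
    Fin.ext_iff]
  simp only [Finset.mem_univ, true_and, Fin.val_zero]
  exact and_congr_right fun _ => eq_comm

variable {n : ℕ} {B η : ℝ} {δ : ℕ} {F : Equiv.Perm (Fin n) → ℝ}

/-- The factor `6 * B` has two sources: each unbalanced permutation may cost `2 * B`, and the defect
of the fiber from `numAdmissible n` costs `B` per missing element. Both numbers are at most twice `2
^ n * (unbalanced n δ).card`. -/
theorem abs_sum_sqFiber_sub_le_of_central {z : Fin n} (hz1 : 6 * δ + 6 ≤ (z : ℕ))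
    (hz2 : (z : ℕ) + 6 * δ + 6 ≤ n) (hB : ∀ σ, |F σ| ≤ B) {c : ℝ} (hc : |c| ≤ B)
    (hη0 : 0 ≤ η) (hη : ∀ σ ∈ sqFiber z, HasBalancedLabels δ σ → |F σ - c| ≤ η) :
    |∑ σ ∈ sqFiber z, F σ - numAdmissible n * c|
      ≤ numAdmissible n * η + 6 * B * (2 ^ n * (unbalanced n δ).card) := by
  classical
  have hB0 : 0 ≤ B := (abs_nonneg _).trans hc
  have h1 : ((sqFiber z).card : ℝ) ≤ numAdmissible n := by
    exact_mod_cast card_sqFiber_le (z := z) (by omega) (by omega)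
  have h2 : (numAdmissible n : ℝ) ≤ (sqFiber z).card + 2 * (2 ^ n * (unbalanced n δ).card) := by
    exact_mod_cast numAdmissible_le_card_sqFiber hz1 hz2
  have h3 : (((sqFiber z).filter fun σ => ¬ HasBalancedLabels δ σ).card : ℝ)
      ≤ 2 * (2 ^ n * (unbalanced n δ).card) := by
    exact_mod_cast card_sqFiber_unbalanced_le δ z
  have h4 : (((sqFiber z).filter fun σ => HasBalancedLabels δ σ).card : ℝ)
      ≤ (sqFiber z).card := by
    exact_mod_cast Finset.card_filter_le _ _
  have e : ∑ σ ∈ sqFiber z, F σ - numAdmissible n * c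
      = ∑ σ ∈ sqFiber z, (F σ - c) - (numAdmissible n - (sqFiber z).card) * c := by
    rw [Finset.sum_sub_distrib, Finset.sum_const, nsmul_eq_mul]
    ring
  have h5 : |∑ σ ∈ sqFiber z, (F σ - c)| ≤ (sqFiber z).card * η
      + 2 * (2 ^ n * (unbalanced n δ).card) * (2 * B) := by
    refine (Finset.abs_sum_le_sum_abs _ _).trans ?_
    rw [← Finset.sum_filter_add_sum_filter_not _ (fun σ => HasBalancedLabels δ σ)]
    refine add_le_add ?_ ?_
    · refine (Finset.sum_le_card_nsmul _ _ η fun σ hσ => ?_).trans ?_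
      · exact hη σ (Finset.mem_filter.1 hσ).1 (Finset.mem_filter.1 hσ).2
      · rw [nsmul_eq_mul]
        exact mul_le_mul_of_nonneg_right h4 hη0
    · refine (Finset.sum_le_card_nsmul _ _ (2 * B) fun σ _ => ?_).trans ?_
      · have := abs_sub (F σ) c
        have := hB σ
        linarith
      · rw [nsmul_eq_mul]
        exact mul_le_mul_of_nonneg_right h3 (by positivity)
  have h6 : |(numAdmissible n - (sqFiber z).card) * c|
      ≤ 2 * (2 ^ n * (unbalanced n δ).card) * B := by
    rw [abs_mul, abs_of_nonneg (sub_nonneg.2 h1)]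
    exact mul_le_mul (by linarith) hc (abs_nonneg _) (by positivity)
  rw [e]
  refine (abs_sub _ _).trans ((add_le_add h5 h6).trans ?_)
  have := mul_le_mul_of_nonneg_right h1 hη0
  linarith

theorem abs_sum_sqFiber_sub_le (hn : 3 ≤ n) (z : Fin n) (hB : ∀ σ, |F σ| ≤ B) {c : ℝ}
    (hc : |c| ≤ B) : |∑ σ ∈ sqFiber z, F σ - numAdmissible n * c| ≤ 33 * B * numAdmissible n := by
  have hB0 : 0 ≤ B := (abs_nonneg _).trans hc
  have h1 : ((sqFiber z).card : ℝ) ≤ 32 * numAdmissible n := by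
    -- The five forced letters account for the factor `2 ^ 5`; `3 ≤ n` keeps the subtractions in the
    -- exponents exact.
    have : 2 ^ n * 2 ^ n = 32 * numAdmissible n := by
      obtain ⟨m, rfl⟩ := Nat.exists_eq_add_of_le hn
      rw [numAdmissible, show 3 + m - 3 = m by omega, show 3 + m - 2 = m + 1 by omega]
      ring
    exact_mod_cast this ▸ card_sqFiber_le' z
  have h2 : |∑ σ ∈ sqFiber z, F σ| ≤ (sqFiber z).card * B := by
    refine (Finset.abs_sum_le_sum_abs _ _).trans ?_
    refine (Finset.sum_le_card_nsmul _ _ B fun σ _ => hB σ).trans ?_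
    rw [nsmul_eq_mul]
  have h3 : |numAdmissible n * c| ≤ numAdmissible n * B := by
    rw [abs_mul, abs_of_nonneg (by positivity)]
    exact mul_le_mul_of_nonneg_left hc (by positivity)
  refine (abs_sub _ _).trans ((add_le_add h2 h3).trans ?_)
  have := mul_le_mul_of_nonneg_right h1 hB0
  linarith

theorem card_not_central_le (n δ : ℕ) :
    (Finset.univ.filter fun z : Fin n =>
      ¬ (6 * δ + 6 ≤ (z : ℕ) ∧ (z : ℕ) + 6 * δ + 6 ≤ n)).card ≤ 12 * (δ + 1) := by
  have h : (Finset.univ.filter fun z : Fin n =>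
      ¬ (6 * δ + 6 ≤ (z : ℕ) ∧ (z : ℕ) + 6 * δ + 6 ≤ n)).map Fin.valEmbedding
      ⊆ Finset.range (6 * δ + 6) ∪ Finset.Ico (n - (6 * δ + 5)) n := by
    intro k hk
    obtain ⟨z, hz, rfl⟩ := Finset.mem_map.1 hk
    have := z.2
    simp only [Finset.mem_filter, Finset.mem_univ, true_and] at hz
    simp only [Finset.mem_union, Finset.mem_range, Finset.mem_Ico, Fin.valEmbedding_apply]
    omega
  have h1 := (Finset.card_le_card h).trans (Finset.card_union_le _ _)
  rw [Finset.card_map, Finset.card_range, Nat.card_Ico] at h1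
  omega

/-- The positions near the ends are handled by the crude bound; there are only `12 * (δ + 1)` of
them, a vanishing proportion of `n`. -/
theorem abs_sum_sqFinset_sub_le [NeZero n] (hn : 3 ≤ n) (hB : ∀ σ, |F σ| ≤ B) {c : Fin n → ℝ}
    (hc : ∀ z, |c z| ≤ B) (hη0 : 0 ≤ η)
    (hη : ∀ z, ∀ σ ∈ sqFiber z, HasBalancedLabels δ σ → |F σ - c z| ≤ η) :
    |∑ σ ∈ sqFinset n, F σ - numAdmissible n * ∑ z, c z|
      ≤ n * (numAdmissible n * η + 6 * B * (2 ^ n * (unbalanced n δ).card))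
        + 12 * (δ + 1) * (33 * B * numAdmissible n) := by
  classical
  have hB0 : 0 ≤ B := (abs_nonneg _).trans (hc 0)
  rw [sum_sqFinset, Finset.mul_sum, ← Finset.sum_sub_distrib]
  refine (Finset.abs_sum_le_sum_abs _ _).trans ?_
  rw [← Finset.sum_filter_add_sum_filter_not _
    (fun z : Fin n => 6 * δ + 6 ≤ (z : ℕ) ∧ (z : ℕ) + 6 * δ + 6 ≤ n)]
  refine add_le_add ?_ ?_
  · refine (Finset.sum_le_card_nsmul _ _ _ fun z hz =>
      abs_sum_sqFiber_sub_le_of_central (Finset.mem_filter.1 hz).2.1 (Finset.mem_filter.1 hz).2.2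
        hB (hc z) hη0 (hη z)).trans ?_
    rw [nsmul_eq_mul]
    refine mul_le_mul_of_nonneg_right ?_ (by positivity)
    have := Finset.card_filter_le (Finset.univ : Finset (Fin n))
      (fun z : Fin n => 6 * δ + 6 ≤ (z : ℕ) ∧ (z : ℕ) + 6 * δ + 6 ≤ n)
    rw [Finset.card_univ, Fintype.card_fin] at this
    exact_mod_cast this
  · refine (Finset.sum_le_card_nsmul _ _ _ fun z _ =>
      abs_sum_sqFiber_sub_le hn z hB (hc z)).trans ?_
    rw [nsmul_eq_mul]
    refine mul_le_mul_of_nonneg_right ?_ (by positivity)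
    exact_mod_cast card_not_central_le n δ

theorem abs_riemann_sum_sub_le [NeZero n] {g : unitInterval → ℝ} (hg : Continuous g)
    (h : ∀ t s : unitInterval, |(t : ℝ) - s| ≤ (n : ℝ)⁻¹ → |g t - g s| ≤ η) :
    |(∑ z : Fin n, g (scaledPos z)) * (n : ℝ)⁻¹ - ∫ t, g t| ≤ η := by
  have hn : (0 : ℝ) < n := by exact_mod_cast Nat.pos_of_ne_zero (NeZero.ne n)
  rw [integral_eq_sum_cell n hg, Finset.sum_mul, abs_sub_comm, ← Finset.sum_sub_distrib]
  refine (Finset.abs_sum_le_sum_abs _ _).trans ?_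
  refine (Finset.sum_le_card_nsmul _ _ (η * (n : ℝ)⁻¹) fun z _ =>
    abs_integral_cell_sub_le z hg fun t ht => h t _ ?_).trans (le_of_eq ?_)
  · obtain ⟨ht1, ht2⟩ := ht
    rw [add_div, one_div] at ht2
    simp only [scaledPos]
    rw [abs_of_nonneg (by linarith)]
    linarith
  · rw [Finset.card_univ, Fintype.card_fin, nsmul_eq_mul]
    field_simp

theorem unbalanced_ratio_le (hn : 3 ≤ n) :
    (2 ^ n * (unbalanced n δ).card : ℝ) / numAdmissible n
      ≤ 192 * ((n : ℝ) ^ 3 / ((δ : ℝ) + 1) ^ 4) := by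
  have h1 : ((unbalanced n δ).card : ℝ) * ((δ : ℝ) + 1) ^ 4 ≤ (n + 1) * (3 * n ^ 2 * 2 ^ n) := by
    exact_mod_cast card_unbalanced_mul_le n δ
  have h2 : (2 : ℝ) ^ n * 2 ^ n = 32 * numAdmissible n := by
    have : 2 ^ n * 2 ^ n = 32 * numAdmissible n := by
      obtain ⟨m, rfl⟩ := Nat.exists_eq_add_of_le hn
      rw [numAdmissible, show 3 + m - 3 = m by omega, show 3 + m - 2 = m + 1 by omega]
      ring
    exact_mod_cast this
  have hN : (0 : ℝ) < numAdmissible n := by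
    unfold numAdmissible
    positivity
  have hn1 : (1 : ℝ) ≤ n := by
    have : 1 ≤ n := by omega
    exact_mod_cast this
  rw [div_le_iff₀ hN, mul_div_assoc', div_mul_eq_mul_div, le_div_iff₀ (by positivity)]
  calc (2 : ℝ) ^ n * ((unbalanced n δ).card : ℝ) * ((δ : ℝ) + 1) ^ 4
      = 2 ^ n * (((unbalanced n δ).card : ℝ) * ((δ : ℝ) + 1) ^ 4) := by ring
    _ ≤ 2 ^ n * (((n : ℝ) + 1) * (3 * (n : ℝ) ^ 2 * 2 ^ n)) := by gcongr
    _ = ((n : ℝ) + 1) * (3 * (n : ℝ) ^ 2) * (2 ^ n * 2 ^ n) := by ring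
    _ = ((n : ℝ) + 1) * (3 * (n : ℝ) ^ 2) * (32 * (numAdmissible n : ℝ)) := by rw [h2]
    _ ≤ ((n : ℝ) + n) * (3 * (n : ℝ) ^ 2) * (32 * (numAdmissible n : ℝ)) := by gcongr
    _ = 192 * (n : ℝ) ^ 3 * (numAdmissible n : ℝ) := by ring

/-- The admitted deviation of the labels of a permutation of size `n`. -/
noncomputable def deviation (n : ℕ) : ℕ := ⌊(n : ℝ) ^ (7 / 8 : ℝ)⌋₊

/-- This limit needs an exponent below `1`, and `tendsto_pow_div_deviation` needs one above `3/4`;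
the exponent `7/8` lies halfway. -/
theorem tendsto_deviation_div :
    Tendsto (fun n : ℕ => ((deviation n : ℝ) + 1) / n) atTop (𝓝 0) := by
  have h1 : Tendsto (fun n : ℕ => (n : ℝ) ^ (-(1 / 8) : ℝ) + (n : ℝ)⁻¹) atTop (𝓝 0) := by
    have := ((tendsto_rpow_neg_atTop (show (0 : ℝ) < 1 / 8 by norm_num)).comp
      tendsto_natCast_atTop_atTop).add (tendsto_inv_atTop_nhds_zero_nat (𝕜 := ℝ))
    simpa using this
  refine squeeze_zero' (Eventually.of_forall fun n => by positivity) ?_ h1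
  filter_upwards [eventually_gt_atTop 0] with n hn
  have hn' : (0 : ℝ) < n := by exact_mod_cast hn
  have h2 : (deviation n : ℝ) ≤ (n : ℝ) ^ (7 / 8 : ℝ) := Nat.floor_le (by positivity)
  have h3 : (n : ℝ) ^ (-(1 / 8) : ℝ) = (n : ℝ) ^ (7 / 8 : ℝ) / n := by
    rw [show (-(1 / 8) : ℝ) = 7 / 8 - 1 by norm_num, Real.rpow_sub hn', Real.rpow_one]
  rw [add_div, h3, one_div]
  gcongr

theorem tendsto_pow_div_deviation :
    Tendsto (fun n : ℕ => (n : ℝ) ^ 3 / ((deviation n : ℝ) + 1) ^ 4) atTop (𝓝 0) := by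
  have h1 : Tendsto (fun n : ℕ => (n : ℝ) ^ (-(1 / 2) : ℝ)) atTop (𝓝 0) :=
    (tendsto_rpow_neg_atTop (show (0 : ℝ) < 1 / 2 by norm_num)).comp tendsto_natCast_atTop_atTop
  refine squeeze_zero' (Eventually.of_forall fun n => by positivity) ?_ h1
  filter_upwards [eventually_gt_atTop 0] with n hn
  have hn' : (0 : ℝ) < n := by exact_mod_cast hn
  have h2 : (n : ℝ) ^ (7 / 8 : ℝ) ≤ (deviation n : ℝ) + 1 := (Nat.lt_floor_add_one _).le
  calc (n : ℝ) ^ 3 / ((deviation n : ℝ) + 1) ^ 4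
      ≤ (n : ℝ) ^ 3 / ((n : ℝ) ^ (7 / 8 : ℝ)) ^ 4 := by gcongr
    _ = (n : ℝ) ^ (-(1 / 2) : ℝ) := by
      rw [← Real.rpow_natCast, ← Real.rpow_natCast, ← Real.rpow_mul hn'.le, ← Real.rpow_sub hn']
      norm_num

/-- The sum of a bounded continuous function over the square permutations, normalized by the
number of triples of an anchor and an admissible pair of words. -/
theorem tendsto_sum_div {f : Permuton → ℝ} (hf : Continuous f) (hB : ∀ p, |f p| ≤ B) :
    Tendsto (fun n : ℕ+ => (∑ σ ∈ sqFinset (n : ℕ), f (permPermuton σ))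
      / ((n : ℕ) * numAdmissible n)) atTop (𝓝 (∫ t, f (rectPermuton t))) := by
  have hg : Continuous fun t => f (rectPermuton t) := hf.comp continuous_rectPermuton
  rw [Metric.tendsto_nhds]
  intro ρ hρ
  -- Three errors are kept below `ρ / 4`: the distance to the rectangle, the exceptional
  -- permutations and positions, and the Riemann sum.
  have hη : 0 < ρ / 4 := by positivity
  obtain ⟨ε, hε, hε'⟩ := exists_err_bound hf hη
  obtain ⟨r, hr, hr'⟩ := Metric.uniformContinuous_iff.1
    (CompactSpace.uniformContinuous_of_continuous hg) (ρ / 4) hη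
  have hv := tendsto_PNat_val_atTop_atTop
  have e1 := hv.eventually (tendsto_deviation_div.eventually_lt_const hε)
  have e2 := hv.eventually (eventually_ge_atTop 3)
  have e3 := hv.eventually
    ((tendsto_inv_atTop_nhds_zero_nat (𝕜 := ℝ)).eventually_lt_const hr)
  have e4 : ∀ᶠ n : ℕ in atTop, 6 * B * (192 * ((n : ℝ) ^ 3 / ((deviation n : ℝ) + 1) ^ 4))
      + 396 * B * (((deviation n : ℝ) + 1) / n) < ρ / 4 := by
    have := ((tendsto_pow_div_deviation.const_mul 192).const_mul (6 * B)).add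
      (tendsto_deviation_div.const_mul (396 * B))
    simp only [mul_zero, add_zero] at this
    exact this.eventually_lt_const hη
  have hB0 : 0 ≤ B := (abs_nonneg _).trans (hB (rectPermuton 0))
  filter_upwards [e1, e2, e3, hv.eventually e4] with n h1 h2 h3 h4
  have hn : (0 : ℝ) < (n : ℕ) := by exact_mod_cast n.pos
  have hN : (0 : ℝ) < numAdmissible n := by
    unfold numAdmissible
    positivity
  have a1 := abs_sum_sqFinset_sub_le (n := n) (δ := deviation n) (B := B) (η := ρ / 4)
    (F := fun σ => f (permPermuton σ)) (c := fun z => f (rectPermuton (scaledPos z))) h2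
    (fun σ => hB _) (fun z => hB _) hη.le fun z σ hσ hb =>
      hε' ⟨n, σ, z, deviation n, (mem_sqFiber.1 hσ).1, (mem_sqFiber.1 hσ).2, hb⟩ h1
  have a2 := abs_riemann_sum_sub_le (n := n) (η := ρ / 4) hg fun t s hts =>
    (hr' (by rw [Subtype.dist_eq, Real.dist_eq]; exact hts.trans_lt h3)).le
  have a3 := mul_le_mul_of_nonneg_left (unbalanced_ratio_le (δ := deviation n) h2)
    (show 0 ≤ 6 * B by positivity)
  rw [Real.dist_eq]
  set A := ∑ σ ∈ sqFinset (n : ℕ), f (permPermuton σ)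
  set G := ∑ z : Fin n, f (rectPermuton (scaledPos z))
  set N : ℝ := (numAdmissible (n : ℕ) : ℝ)
  set E : ℝ := 2 ^ (n : ℕ) * ((unbalanced n (deviation n)).card : ℝ)
  have a4 : |A / ((n : ℕ) * N) - G * ((n : ℕ) : ℝ)⁻¹|
      ≤ ρ / 4 + 6 * B * (E / N) + 396 * B * (((deviation n : ℝ) + 1) / (n : ℕ)) := by
    have : A / ((n : ℕ) * N) - G * ((n : ℕ) : ℝ)⁻¹ = (A - N * G) / ((n : ℕ) * N) := by
      field_simp
    rw [this, abs_div, abs_of_pos (mul_pos hn hN), div_le_iff₀ (mul_pos hn hN)]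
    refine a1.trans (le_of_eq ?_)
    field_simp
    ring
  refine (abs_sub_le _ (G * ((n : ℕ) : ℝ)⁻¹) _).trans_lt ?_
  linarith

end Averages

/-! ### Uniform square permutations and the limit theorem. -/

theorem integral_uniformOn_sq (n : ℕ) (F : Equiv.Perm (Fin n) → ℝ) :
    ∫ s : Sq n, F s.1 ∂(uniformOn Set.univ)
      = (∑ σ ∈ sqFinset n, F σ) / (∑ _σ ∈ sqFinset n, (1 : ℝ)) := by
  classical
  let _ : Fintype (Sq n) := Fintype.ofFinite _
  have hsum : ∀ G : Equiv.Perm (Fin n) → ℝ, ∑ σ ∈ sqFinset n, G σ = ∑ s : Sq n, G s.1 :=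
    fun G => Finset.sum_subtype (sqFinset n) (fun σ => by simp [sqFinset]) G
  rw [integral_fintype (Integrable.of_finite), hsum, hsum, Finset.sum_div]
  refine Finset.sum_congr rfl fun s _ => ?_
  rw [Measure.real, uniformOn_univ, Measure.count_singleton, smul_eq_mul, one_div,
    ENNReal.toReal_inv, ENNReal.toReal_natCast]
  simp [div_eq_inv_mul]

/-- The constant function `1` in `tendsto_sum_div` shows that the number of square permutations is
asymptotic to `n * numAdmissible n`, so the normalization cancels in the quotient. -/
theorem tendsto_integral_uniformOn_sq {f : Permuton → ℝ} (hf : Continuous f) {B : ℝ}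
    (hB : ∀ p, |f p| ≤ B) :
    Tendsto (fun n : ℕ+ => ∫ s : Sq n, f (permPermuton s.1) ∂(uniformOn Set.univ)) atTop
      (𝓝 (∫ t, f (rectPermuton t))) := by
  have h1 := tendsto_sum_div hf hB
  have h2 := tendsto_sum_div (f := fun _ => (1 : ℝ)) (B := 1) continuous_const (by simp)
  have h3 := h1.div h2 (by simp)
  simp only [integral_const, smul_eq_mul, mul_one, probReal_univ, div_one] at h3
  refine h3.congr fun n => ?_
  rw [integral_uniformOn_sq n fun σ => f (permPermuton σ)]
  have hn : ((n : ℕ) : ℝ) * (numAdmissible n : ℝ) ≠ 0 := by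
    unfold numAdmissible
    have := n.pos
    positivity
  exact div_div_div_cancel_right₀ hn _ _

theorem integral_Ioo_rectPermuton {f : Permuton → ℝ} :
    ∫ x, f (rectPermuton (projIcc 0 1 zero_le_one x)) ∂(volume.restrict (Set.Ioo (0 : ℝ) 1))
      = ∫ t, f (rectPermuton t) := by
  rw [← integral_Icc_eq_integral_Ioo, ← integral_subtype measurableSet_Icc]
  simp only [projIcc_val]

end SquarePermuton

/-- For every `n ≥ 1` let `σ n` be a uniform random element of `Sq n`, and let `z` be uniform on
`(0, 1)`. Then the random permuton of `σ n` converges in distribution to `μ^z`. -/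
theorem theorem4p3 {Ω : ℕ+ → Type*} [∀ n, MeasurableSpace (Ω n)]
    (P : ∀ n, Measure (Ω n)) [∀ n, IsProbabilityMeasure (P n)]
    (σ : ∀ n : ℕ+, Ω n → SquarePermuton.Sq (n : ℕ))
    (hσ : ∀ n, HasLaw (σ n) (uniformOn Set.univ) (P n))
    {Ω' : Type*} [MeasurableSpace Ω'] (P' : Measure Ω') [IsProbabilityMeasure P']
    (z : Ω' → Set.Ioo (0 : ℝ) 1)
    (hz : HasLaw (fun ω => (z ω : ℝ)) (volume.restrict (Set.Ioo (0 : ℝ) 1)) P') :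
    TendstoInDistribution
      (fun (n : ℕ+) (ω : Ω n) => SquarePermuton.permPermuton (n := (n : ℕ)) (σ n ω).1)
      atTop
      (fun ω : Ω' => SquarePermuton.rectPermuton (Set.inclusion Set.Ioo_subset_Icc_self (z ω)))
      P P' := by

  have hm1 : ∀ n, AEMeasurable
      (fun ω : Ω n => SquarePermuton.permPermuton (n := (n : ℕ)) (σ n ω).1) (P n) := fun n =>
    (measurable_of_countable
      (fun s : SquarePermuton.Sq n => SquarePermuton.permPermuton s.1)).comp_aemeasurable
      (hσ n).aemeasurable
  -- The law of `z` lives on the real line, so the family of rectangles is extended there by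
  -- projection to the unit interval.
  have hcont : Continuous fun x : ℝ =>
      SquarePermuton.rectPermuton (projIcc 0 1 zero_le_one x) :=
    SquarePermuton.continuous_rectPermuton.comp continuous_projIcc
  have hproj : (fun ω : Ω' =>
      SquarePermuton.rectPermuton (Set.inclusion Set.Ioo_subset_Icc_self (z ω)))
      = fun ω => SquarePermuton.rectPermuton (projIcc 0 1 zero_le_one (z ω : ℝ)) := by
    funext ω
    rw [projIcc_of_mem zero_le_one (Set.Ioo_subset_Icc_self (z ω).2)]
  have hm2 : AEMeasurable (fun ω : Ω' =>
      SquarePermuton.rectPermuton (Set.inclusion Set.Ioo_subset_Icc_self (z ω))) P' := by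
    rw [hproj]
    exact hcont.measurable.comp_aemeasurable hz.aemeasurable
  refine ⟨hm1, hm2, ?_⟩
  refine ProbabilityMeasure.tendsto_iff_forall_integral_tendsto.2 fun f => ?_
  have h1 := SquarePermuton.tendsto_integral_uniformOn_sq f.continuous fun p => f.norm_coe_le_norm p
  have hfc : Continuous fun x : ℝ => f (SquarePermuton.rectPermuton (projIcc 0 1 zero_le_one x)) :=
    f.continuous.comp hcont
  have e1 : ∀ n : ℕ+, ∫ s : SquarePermuton.Sq n, f (SquarePermuton.permPermuton s.1)
      ∂(uniformOn Set.univ) = ∫ p, f p ∂((P n).map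
        fun ω => SquarePermuton.permPermuton (n := (n : ℕ)) (σ n ω).1) := fun n => by
    rw [integral_map (hm1 n) f.continuous.measurable.aestronglyMeasurable, ← (hσ n).map_eq]
    exact integral_map (hσ n).aemeasurable (measurable_of_countable _).aestronglyMeasurable
  have e2 : ∫ t, f (SquarePermuton.rectPermuton t) = ∫ p, f p ∂(P'.map fun ω =>
      SquarePermuton.rectPermuton (Set.inclusion Set.Ioo_subset_Icc_self (z ω))) := by
    rw [integral_map hm2 f.continuous.measurable.aestronglyMeasurable,
      ← SquarePermuton.integral_Ioo_rectPermuton, ← hz.map_eq,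
      integral_map hz.aemeasurable hfc.measurable.aestronglyMeasurable]
    exact integral_congr_ae (Eventually.of_forall fun ω => congrArg f (congrFun hproj ω).symm)
  exact (h1.congr e1).mono_right (le_of_eq (congrArg 𝓝 e2))
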